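/- Let $\alpha,\beta,\lambda,\phi\in\mathbb R$ with $\alpha\neq 0$, and put $\tilde\phi=\phi+\frac{\lambda\beta}{\alpha}$, $\theta=\frac{\alpha}{2}$, $A=\frac{\alpha^2}{8}\left(\tilde\phi-\frac{\alpha}{4}\right)\left(\tilde\phi-\frac{3\alpha}{4}\right)$, $B_0=\frac{\lambda^2}{8}$. Let $J\subseteq\mathbb R$ be a nonempty open interval, with $0\notin J$ unless $A=0$ (for instance $J=(0,\infty)$, or $J=\mathbb R$ when $A=0$), and let $$V(t,q)=\frac{A}{q^2}+B_0q^2\qquad(t\in\mathbb R,\ q\in J),$$ where $A/q^2$ is read as $0$ if $A=0$. On $\mathbf M=\{(t,q,S,E,B)\in\mathbb R^5: q\in J\}$ let $I$ be the ideal of the algebra of smooth differential forms generated by $$\omega=dS+E\,dt+B\,dq,\qquad d\omega=dE\wedge dt+dB\wedge dq,\qquad \left(E+\tfrac{B^2}{2}-V\right)dq\wedge dt+\tfrac{\theta^2}{2}\,dB\wedge dt .$$ Let $\mathcal G_V$ be the Lie algebra of isovectors, i.e. of the smooth vector fields $N$ on $\mathbf M$ with $\mathcal L_N(I)\subseteq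 I$; write $N^t,N^q,N^S,\dots$ for the components of $N$. Let $\mathcal J_V\subseteq\mathcal G_V$ consist of the isovectors with $N^t=N^q=0$ and $N^S=e^{S/\theta^2}u(t,q)$ for some function $u$, and let $\mathcal H_V=\{N\in\mathcal G_V:\partial N^S/\partial S=0\}$. Then $\mathcal H_V$ is a supplement of $\mathcal J_V$, that is, $\mathcal G_V=\mathcal J_V\oplus\mathcal H_V$ as real vector spaces, and $\dim_{\mathbb R}\mathcal H_V=6$ if $A=0$, while $\dim_{\mathbb R}\mathcal H_V=4$ if $A\neq0$. Moreover, $\dim_{\mathbb R}\mathcal H_V=6$ if and only if $\tilde\phi\in\{\alpha/4,\,3\alpha/4\}$. -/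

import Mathlib

open scoped ContDiff

noncomputable section

namespace HJB

/-! ### Smooth functions, vector fields and differential forms on an open subset of `ℝ⁵`

The coordinates `(t, q, S, E, B)` carry the indices `0, 1, 2, 3, 4`. -/

/-- The ambient space `ℝ⁵` of the coordinates `(t, q, S, E, B)`. -/
abbrev Coords : Type := Fin 5 → ℝ

variable {M : TopologicalSpace.Opens Coords}

/-- The extension by zero of a function on `M`; only its values on the open set `M` matter. -/
def extendZero (f : M → ℝ) : Coords → ℝ := Function.extend Subtype.val f 0

theorem extendZero_apply (f : M → ℝ) (x : M) : extendZero f x = f x :=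
  Subtype.val_injective.extend_apply f 0 x

theorem extendZero_apply' (f : M → ℝ) {x : Coords} (hx : x ∈ M) : extendZero f x = f ⟨x, hx⟩ :=
  extendZero_apply f ⟨x, hx⟩

theorem contDiffOn_extendZero {f : M → ℝ} {g : Coords → ℝ}
    (hg : ContDiffOn ℝ ∞ g (M : Set Coords)) (h : ∀ x : M, f x = g x) :
    ContDiffOn ℝ ∞ (extendZero f) (M : Set Coords) :=
  hg.congr fun x hx => by rw [extendZero_apply' f hx, h ⟨x, hx⟩]

variable (M) in
/-- The smooth real functions on the open set `M ⊆ ℝ⁵`, as a subalgebra of all functions. -/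
def smoothSubalgebra : Subalgebra ℝ (M → ℝ) where
  carrier := {f | ContDiffOn ℝ ∞ (extendZero f) (M : Set Coords)}
  mul_mem' {f g} hf hg :=
    contDiffOn_extendZero (ContDiffOn.mul hf hg) fun x => by simp [extendZero_apply]
  add_mem' {f g} hf hg :=
    contDiffOn_extendZero (ContDiffOn.add hf hg) fun x => by simp [extendZero_apply]
  algebraMap_mem' r := contDiffOn_extendZero (g := fun _ => r) contDiffOn_const fun _ => rfl

variable (M) in
/-- The algebra `C^∞(M)` of smooth real functions on the open set `M ⊆ ℝ⁵`. -/
def SmoothFn : Type := smoothSubalgebra M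

instance : CommRing (SmoothFn M) := inferInstanceAs (CommRing (smoothSubalgebra M))

instance : Algebra ℝ (SmoothFn M) := inferInstanceAs (Algebra ℝ (smoothSubalgebra M))

/-- The function underlying an element of `C^∞(M)`. -/
def SmoothFn.val (f : SmoothFn M) : M → ℝ := Subtype.val (p := (· ∈ smoothSubalgebra M)) f

theorem SmoothFn.smooth (f : SmoothFn M) :
    ContDiffOn ℝ ∞ (extendZero f.val) (M : Set Coords) :=
  Subtype.property (p := (· ∈ smoothSubalgebra M)) f

/-- A smooth function, as an element of `C^∞(M)`. -/
def SmoothFn.mk (f : M → ℝ) (hf : ContDiffOn ℝ ∞ (extendZero f) (M : Set Coords)) : SmoothFn M :=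
  Subtype.mk (p := (· ∈ smoothSubalgebra M)) f hf

theorem SmoothFn.mk_val (f : M → ℝ) (hf : ContDiffOn ℝ ∞ (extendZero f) (M : Set Coords)) :
    (SmoothFn.mk f hf).val = f := rfl

theorem SmoothFn.ext {f g : SmoothFn M} (h : ∀ x, f.val x = g.val x) : f = g :=
  Subtype.ext (funext h)

theorem SmoothFn.add_apply (f g : SmoothFn M) (x : M) : (f + g).val x = f.val x + g.val x := rfl

theorem SmoothFn.mul_apply (f g : SmoothFn M) (x : M) : (f * g).val x = f.val x * g.val x := rfl

theorem SmoothFn.smul_apply (r : ℝ) (f : SmoothFn M) (x : M) : (r • f).val x = r * f.val x := rfl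

theorem SmoothFn.zero_apply (x : M) : (0 : SmoothFn M).val x = 0 := rfl

theorem SmoothFn.one_apply (x : M) : (1 : SmoothFn M).val x = 1 := rfl

theorem differentiableAt_extendZero (f : SmoothFn M) (x : M) :
    DifferentiableAt ℝ (extendZero f.val) x :=
  (f.smooth.contDiffAt (M.isOpen.mem_nhds x.2)).differentiableAt (by simp)

theorem extendZero_eventuallyEq {f : M → ℝ} {g : Coords → ℝ} (h : ∀ x : M, f x = g x) (x : M) :
    extendZero f =ᶠ[nhds (x : Coords)] g := by
  filter_upwards [M.isOpen.mem_nhds x.2] with y hy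
  rw [extendZero_apply' f hy, h ⟨y, hy⟩]

/-- The partial derivative `∂/∂xⁱ`, as a derivation of `C^∞(M)`. -/
@[irreducible] def pderiv (i : Fin 5) : Derivation ℝ (SmoothFn M) (SmoothFn M) where
  toFun f := SmoothFn.mk (fun x => fderiv ℝ (extendZero f.val) x (Pi.single i 1))
    (contDiffOn_extendZero (g := fun x => fderiv ℝ (extendZero f.val) x (Pi.single i 1))
      ((f.smooth.fderiv_of_isOpen M.isOpen (by simp)).clm_apply contDiffOn_const) fun _ => rfl)
  map_add' f g := by
    refine SmoothFn.ext fun x => ?_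
    have h := extendZero_eventuallyEq (f := (f + g : SmoothFn M).val)
      (g := extendZero f.val + extendZero g.val)
      (fun y => by simp [extendZero_apply, SmoothFn.add_apply]) x
    change fderiv ℝ (extendZero (f + g : SmoothFn M).val) x (Pi.single i 1) =
      fderiv ℝ (extendZero f.val) x (Pi.single i 1) + fderiv ℝ (extendZero g.val) x (Pi.single i 1)
    rw [h.fderiv_eq, fderiv_add (differentiableAt_extendZero f x)
      (differentiableAt_extendZero g x)]
    rfl
  map_smul' r f := by
    refine SmoothFn.ext fun x => ?_
    have h := extendZero_eventuallyEq (f := (r • f : SmoothFn M).val)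
      (g := r • extendZero f.val) (fun y => by simp [extendZero_apply, SmoothFn.smul_apply]) x
    change fderiv ℝ (extendZero (r • f : SmoothFn M).val) x (Pi.single i 1) =
      r * fderiv ℝ (extendZero f.val) x (Pi.single i 1)
    rw [h.fderiv_eq, fderiv_const_smul (differentiableAt_extendZero f x)]
    rfl
  map_one_eq_zero' := by
    refine SmoothFn.ext fun x => ?_
    have h := extendZero_eventuallyEq (f := (1 : SmoothFn M).val)
      (g := fun _ => (1 : ℝ)) (fun y => rfl) x
    change fderiv ℝ (extendZero (1 : SmoothFn M).val) x (Pi.single i 1) = 0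
    rw [h.fderiv_eq]
    simp
  leibniz' f g := by
    refine SmoothFn.ext fun x => ?_
    have h := extendZero_eventuallyEq (f := (f * g : SmoothFn M).val)
      (g := extendZero f.val * extendZero g.val) (fun y => by simp [extendZero_apply, SmoothFn.mul_apply]) x
    change fderiv ℝ (extendZero (f * g : SmoothFn M).val) x (Pi.single i 1) =
      f.val x * fderiv ℝ (extendZero g.val) x (Pi.single i 1) +
      g.val x * fderiv ℝ (extendZero f.val) x (Pi.single i 1)
    rw [h.fderiv_eq, fderiv_mul (differentiableAt_extendZero f x) (differentiableAt_extendZero g x)]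
    simp [extendZero_apply]

theorem pderiv_apply (i : Fin 5) (f : SmoothFn M) (x : M) :
    (pderiv i f).val x = fderiv ℝ (extendZero f.val) x (Pi.single i 1) := by
  unfold pderiv; rfl

/-- The coordinate function `xⁱ` on `M`. -/
def coord (i : Fin 5) : SmoothFn M :=
  SmoothFn.mk (fun x => x.1 i) (contDiffOn_extendZero (g := fun x => x i)
    (contDiff_apply ℝ ℝ i).contDiffOn fun _ => rfl)

theorem coord_apply (i : Fin 5) (x : M) : (coord i : SmoothFn M).val x = x.1 i := rfl

variable (M) in
/-- Smooth vector fields `N = ∑ Nⁱ ∂/∂xⁱ` on `M`, given by their components. -/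
abbrev VField : Type := Fin 5 → SmoothFn M

variable (M) in
/-- Smooth `1`-forms `∑ ηᵢ dxⁱ` on `M`, given by their coefficients. -/
abbrev OneForm : Type := Fin 5 → SmoothFn M

variable (M) in
/-- The algebra of smooth differential forms on `M`: the exterior algebra over `C^∞(M)` of the
free module of `1`-forms. Its product is the wedge product. -/
abbrev Forms : Type := ExteriorAlgebra (SmoothFn M) (OneForm M)

/-- The vector field `N` acting on functions: `N f = ∑ Nⁱ ∂f/∂xⁱ`. -/
@[irreducible] def VField.act (N : VField M) : Derivation ℝ (SmoothFn M) (SmoothFn M) :=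
  ∑ i, N i • pderiv i

/-- The differential `df = ∑ (∂f/∂xⁱ) dxⁱ` of a function. -/
def diff (f : SmoothFn M) : OneForm M := fun i => pderiv i f

/-- The Lie derivative of a `1`-form: `L_N (∑ ηᵢ dxⁱ) = ∑ (N ηᵢ) dxⁱ + ∑ ηᵢ dNⁱ`. -/
@[irreducible] def lieOne (N : VField M) (η : OneForm M) : OneForm M :=
  (fun j => N.act (η j)) + ∑ i, η i • diff (N i)

theorem lieOne_add (N : VField M) (η ζ : OneForm M) :
    lieOne N (η + ζ) = lieOne N η + lieOne N ζ := by
  ext1 j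
  simp [lieOne, Finset.sum_add_distrib, add_mul]
  ring

theorem lieOne_smul (N : VField M) (f : SmoothFn M) (η : OneForm M) :
    lieOne N (f • η) = f • lieOne N η + N.act f • η := by
  ext1 j
  simp [lieOne, Finset.mul_sum, mul_assoc]
  ring

theorem ι_smul (f : SmoothFn M) (η : OneForm M) : ExteriorAlgebra.ι (SmoothFn M) (f • η) =
    algebraMap _ (Forms M) f * ExteriorAlgebra.ι (SmoothFn M) η :=
  ((ExteriorAlgebra.ι (SmoothFn M)).map_smul f η).trans (Algebra.smul_def _ _)

/-! The Lie derivative on all forms is the derivation of the algebra of forms that extends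
`f ↦ N f` and `lieOne N`. It is the `ε`-part of the ring homomorphism `η ↦ η + ε L_N η` into the
dual numbers over the algebra of forms, which the universal property of the exterior algebra
provides. -/

/-- The dual numbers over the algebra of forms, as an algebra over `C^∞(M)` through
`f ↦ f + ε (N f)`. -/
def TwistedDual (_N : VField M) : Type := DualNumber (Forms M)

instance (N : VField M) : Ring (TwistedDual N) := inferInstanceAs (Ring (DualNumber (Forms M)))

/-- The ring homomorphism `f ↦ f + ε (N f)`. -/
def twist (N : VField M) : SmoothFn M →+* TwistedDual N where
  toFun f := ((algebraMap _ (Forms M) f, algebraMap _ (Forms M) (N.act f)) :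
    Forms M × Forms M)
  map_one' := by
    refine TrivSqZeroExt.ext ?_ ?_
    · exact map_one _
    · change algebraMap _ (Forms M) (N.act 1) = 0
      simp
  map_mul' f g := by
    refine TrivSqZeroExt.ext ?_ ?_
    · exact map_mul _ f g
    · change algebraMap _ (Forms M) (N.act (f * g)) =
        algebraMap _ (Forms M) f * algebraMap _ (Forms M) (N.act g) +
          algebraMap _ (Forms M) (N.act f) * algebraMap _ (Forms M) g
      rw [← map_mul, ← map_mul, ← map_add, Derivation.leibniz]
      congr 1
      simp [mul_comm]
  map_zero' := by
    refine TrivSqZeroExt.ext ?_ ?_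
    · exact map_zero _
    · change algebraMap _ (Forms M) (N.act 0) = 0
      simp
  map_add' f g := by
    refine TrivSqZeroExt.ext ?_ ?_
    · exact map_add _ f g
    · change algebraMap _ (Forms M) (N.act (f + g)) =
        algebraMap _ (Forms M) (N.act f) + algebraMap _ (Forms M) (N.act g)
      rw [map_add, map_add]

instance (N : VField M) : Algebra (SmoothFn M) (TwistedDual N) :=
  (twist N).toAlgebra' fun f x => by
    refine TrivSqZeroExt.ext ?_ ?_
    · exact Algebra.commutes f _
    · change algebraMap _ (Forms M) f * TrivSqZeroExt.snd x +
          algebraMap _ (Forms M) (N.act f) * TrivSqZeroExt.fst x =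
        TrivSqZeroExt.fst x * algebraMap _ (Forms M) (N.act f) +
          TrivSqZeroExt.snd x * algebraMap _ (Forms M) f
      rw [Algebra.commutes f, Algebra.commutes (N.act f), add_comm]

/-- The map `η ↦ η + ε L_N η` on `1`-forms. -/
def twistOne (N : VField M) : OneForm M →ₗ[SmoothFn M] TwistedDual N where
  toFun η := ((ExteriorAlgebra.ι (SmoothFn M) η, ExteriorAlgebra.ι (SmoothFn M) (lieOne N η)) :
    Forms M × Forms M)
  map_add' η ζ := by
    refine TrivSqZeroExt.ext ?_ ?_
    · exact map_add _ η ζ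
    · change ExteriorAlgebra.ι (SmoothFn M) (lieOne N (η + ζ)) =
        ExteriorAlgebra.ι (SmoothFn M) (lieOne N η) + ExteriorAlgebra.ι (SmoothFn M) (lieOne N ζ)
      rw [lieOne_add, map_add]
  map_smul' f η := by
    rw [RingHom.id_apply, Algebra.smul_def]
    refine TrivSqZeroExt.ext ?_ ?_
    · exact ι_smul f η
    · change ExteriorAlgebra.ι (SmoothFn M) (lieOne N (f • η)) =
        algebraMap _ (Forms M) f * ExteriorAlgebra.ι (SmoothFn M) (lieOne N η) +
          algebraMap _ (Forms M) (N.act f) * ExteriorAlgebra.ι (SmoothFn M) η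
      rw [lieOne_smul, map_add, ι_smul f, ι_smul (N.act f)]

theorem twistOne_sq (N : VField M) (η : OneForm M) : twistOne N η * twistOne N η = 0 := by
  refine TrivSqZeroExt.ext ?_ ?_
  · exact ExteriorAlgebra.ι_sq_zero η
  · exact ExteriorAlgebra.ι_add_mul_swap η (lieOne N η)

/-- The homomorphism `η ↦ η + ε L_N η` on all forms. -/
def twistForms (N : VField M) : Forms M →ₐ[SmoothFn M] TwistedDual N :=
  ExteriorAlgebra.lift (SmoothFn M) ⟨twistOne N, twistOne_sq N⟩

/-- The Lie derivative `L_N` on differential forms. -/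
def lieDeriv (N : VField M) (η : Forms M) : Forms M :=
  TrivSqZeroExt.snd (R := Forms M) (M := Forms M) (twistForms N η)

theorem fst_twistForms (N : VField M) (η : Forms M) :
    TrivSqZeroExt.fst (R := Forms M) (M := Forms M) (twistForms N η) = η := by
  induction η using ExteriorAlgebra.induction with
  | algebraMap f => rw [AlgHom.commutes]; rfl
  | ι η => rw [twistForms, ExteriorAlgebra.lift_ι_apply]; rfl
  | mul a b ha hb =>
    rw [map_mul]
    exact (TrivSqZeroExt.fst_mul (R := Forms M) (M := Forms M) _ _).trans (by rw [ha, hb])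
  | add a b ha hb =>
    rw [map_add]
    exact (TrivSqZeroExt.fst_add (R := Forms M) (M := Forms M) _ _).trans (by rw [ha, hb])

theorem lieDeriv_algebraMap (N : VField M) (f : SmoothFn M) :
    lieDeriv N (algebraMap _ _ f) = algebraMap _ _ (N.act f) := by
  rw [lieDeriv, AlgHom.commutes]; rfl

theorem lieDeriv_ι (N : VField M) (η : OneForm M) :
    lieDeriv N (ExteriorAlgebra.ι _ η) = ExteriorAlgebra.ι _ (lieOne N η) := by
  rw [lieDeriv, twistForms, ExteriorAlgebra.lift_ι_apply]; rfl

theorem lieDeriv_add (N : VField M) (a b : Forms M) :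
    lieDeriv N (a + b) = lieDeriv N a + lieDeriv N b := by
  rw [lieDeriv, map_add]; rfl

theorem lieDeriv_mul (N : VField M) (a b : Forms M) :
    lieDeriv N (a * b) = lieDeriv N a * b + a * lieDeriv N b := by
  rw [lieDeriv, map_mul]
  refine (TrivSqZeroExt.snd_mul (R := Forms M) (M := Forms M) _ _).trans ?_
  rw [fst_twistForms, fst_twistForms, add_comm]; rfl

theorem act_add (N N' : VField M) : (N + N').act = N.act + N'.act := by
  simp [VField.act, add_smul, Finset.sum_add_distrib]

theorem act_smul (r : ℝ) (N : VField M) : (r • N).act = r • N.act := by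
  simp [VField.act, Finset.smul_sum]

theorem lieOne_add_left (N N' : VField M) (η : OneForm M) :
    lieOne (N + N') η = lieOne N η + lieOne N' η := by
  ext1 j
  simp [lieOne, act_add, diff, Finset.sum_add_distrib, mul_add]
  ring

theorem lieOne_smul_left (r : ℝ) (N : VField M) (η : OneForm M) :
    lieOne (r • N) η = algebraMap ℝ (SmoothFn M) r • lieOne N η := by
  ext1 j
  have h : (r • N).act (η j) = algebraMap ℝ (SmoothFn M) r * N.act (η j) := by
    rw [act_smul, Derivation.smul_apply, Algebra.smul_def]
  have h' (i : Fin 5) : pderiv j (r • N i) = algebraMap ℝ (SmoothFn M) r * pderiv j (N i) := by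
    rw [Derivation.map_smul, Algebra.smul_def]
  simp only [lieOne, Pi.add_apply, Finset.sum_apply, Pi.smul_apply, diff, h, h', smul_eq_mul,
    mul_add, Finset.mul_sum, mul_left_comm]

theorem lieDeriv_add_left (N N' : VField M) (η : Forms M) :
    lieDeriv (N + N') η = lieDeriv N η + lieDeriv N' η := by
  induction η using ExteriorAlgebra.induction with
  | algebraMap f => simp [lieDeriv_algebraMap, act_add]
  | ι η => simp [lieDeriv_ι, lieOne_add_left]
  | mul a b ha hb => simp only [lieDeriv_mul, ha, hb, add_mul, mul_add]; abel
  | add a b ha hb => simp only [lieDeriv_add, ha, hb]; abel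

theorem lieDeriv_smul_left (r : ℝ) (N : VField M) (η : Forms M) :
    lieDeriv (r • N) η = algebraMap (SmoothFn M) _ (algebraMap ℝ _ r) * lieDeriv N η := by
  induction η using ExteriorAlgebra.induction with
  | algebraMap f =>
    rw [lieDeriv_algebraMap, lieDeriv_algebraMap, act_smul, ← map_mul, Derivation.smul_apply,
      Algebra.smul_def]
  | ι η =>
    rw [lieDeriv_ι (r • N) η, lieDeriv_ι N η, lieOne_smul_left, ι_smul (algebraMap ℝ _ r)]
  | mul a b ha hb =>
    rw [lieDeriv_mul, lieDeriv_mul, ha, hb, mul_add, mul_assoc, ← mul_assoc a,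
      ← Algebra.commutes _ a, mul_assoc]
  | add a b ha hb => simp only [lieDeriv_add, ha, hb, mul_add]

/-! ### The Hamilton–Jacobi–Bellman ideal and its isovectors -/

/-- The differential `dxⁱ` of a coordinate, as an element of the algebra of forms. -/
def dx (i : Fin 5) : Forms M := ExteriorAlgebra.ι _ (diff (coord i))

/-- The function `f`, as a form of degree zero. -/
def fn (f : SmoothFn M) : Forms M := algebraMap _ _ f

/-- `ω = dS + E dt + B dq`. -/
def formω : Forms M := dx 2 + fn (coord 3) * dx 0 + fn (coord 4) * dx 1

/-- `Ω = dω = dE ∧ dt + dB ∧ dq`. -/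
def formΩ : Forms M := dx 3 * dx 0 + dx 4 * dx 1

/-- `β = (E + B²/2 - V) dq ∧ dt + (θ²/2) dB ∧ dt`. -/
def formβ (θ : ℝ) (V : SmoothFn M) : Forms M :=
  fn (coord 3 + (1 / 2 : ℝ) • coord 4 ^ 2 - V) * (dx 1 * dx 0) +
    fn (algebraMap ℝ _ (θ ^ 2 / 2)) * (dx 4 * dx 0)

/-- The ideal of forms generated by `ω`, `dω` and `β`. As these generators are homogeneous, the
left ideal that they generate is two-sided. -/
def hjbIdeal (θ : ℝ) (V : SmoothFn M) : Ideal (Forms M) :=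
  Ideal.span {formω, formΩ, formβ θ V}

/-- The space `𝒢_V` of isovectors: the vector fields `N` with `L_N(I) ⊆ I`. -/
def isovectors (θ : ℝ) (V : SmoothFn M) : Submodule ℝ (VField M) where
  carrier := {N | ∀ η ∈ hjbIdeal θ V, lieDeriv N η ∈ hjbIdeal θ V}
  add_mem' {N N'} h h' η hη := by
    rw [lieDeriv_add_left]; exact add_mem (h η hη) (h' η hη)
  zero_mem' η _ := by
    have h := lieDeriv_smul_left (0 : ℝ) (0 : VField M) η
    rw [zero_smul, map_zero, map_zero, zero_mul] at h
    rw [h]; exact zero_mem _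
  smul_mem' r N h η hη := by
    rw [lieDeriv_smul_left]; exact Ideal.mul_mem_left _ _ (h η hη)

/-- The ideal `𝒥_V` of `𝒢_V` that comes from the linearity of
`θ² ∂ψ/∂t = -(θ⁴/2) ∂²ψ/∂q² + V ψ`: the infinitesimal form of `ψ ↦ ψ + ε u` in the variable
`S = -θ² ln ψ`, that is, `Nᵗ = N^q = 0` and `N^S = e^{S/θ²} u(t,q)` (a factor `-θ²` is absorbed
in `u`; that `u` solves the linear equation is part of `N` being an isovector). -/
def superposition (θ : ℝ) (V : SmoothFn M) : Submodule ℝ (VField M) where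
  carrier := {N | N ∈ isovectors θ V ∧ N 0 = 0 ∧ N 1 = 0 ∧
    ∃ u : ℝ → ℝ → ℝ, ∀ x : M, (N 2).val x = Real.exp (x.1 2 / θ ^ 2) * u (x.1 0) (x.1 1)}
  add_mem' := by
    rintro N N' ⟨h, h0, h1, u, hu⟩ ⟨h', h0', h1', u', hu'⟩
    refine ⟨add_mem h h', by simp [h0, h0'], by simp [h1, h1'], fun t q => u t q + u' t q,
      fun x => ?_⟩
    simp [SmoothFn.add_apply, hu, hu', mul_add]
  zero_mem' := ⟨zero_mem _, rfl, rfl, fun _ _ => 0, fun x => by simp [SmoothFn.zero_apply]⟩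
  smul_mem' := by
    rintro r N ⟨h, h0, h1, u, hu⟩
    refine ⟨Submodule.smul_mem _ r h, by simp [h0], by simp [h1], fun t q => r * u t q,
      fun x => ?_⟩
    simp [SmoothFn.smul_apply, hu, mul_left_comm]

/-- The canonical supplement `ℋ_V` of `𝒥_V` in `𝒢_V`: the isovectors `N` whose phase
`Φ_N = -N^S` does not depend on `S`. -/
def canonicalSupplement (θ : ℝ) (V : SmoothFn M) : Submodule ℝ (VField M) where
  carrier := {N | N ∈ isovectors θ V ∧ pderiv 2 (N 2) = 0}
  add_mem' h h' := ⟨add_mem h.1 h'.1, by simp [h.2, h'.2]⟩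
  zero_mem' := ⟨zero_mem _, by simp⟩
  smul_mem' r _ h := ⟨Submodule.smul_mem _ r h.1, by simp [h.2]⟩

/-! ### The potential of a one-factor affine interest rate model -/

/-- The domain `{(t, q, S, E, B) : q ∈ J}`. -/
def phaseSpace (J : TopologicalSpace.Opens ℝ) : TopologicalSpace.Opens Coords :=
  ⟨{x | x 1 ∈ J}, J.isOpen.preimage (continuous_apply 1)⟩

/-- The potential `V(t,q) = a/q² + b q²`, on a domain on which it is smooth. -/
def potential (J : TopologicalSpace.Opens ℝ) (a b : ℝ) (h : a = 0 ∨ (0 : ℝ) ∉ J) :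
    SmoothFn (phaseSpace J) :=
  SmoothFn.mk (fun x => a / x.1 1 ^ 2 + b * x.1 1 ^ 2) (contDiffOn_extendZero
    (g := fun x => a / x 1 ^ 2 + b * x 1 ^ 2) (by
      have hc : ContDiffOn ℝ ∞ (fun x : Coords => x 1) (phaseSpace J : Set Coords) :=
        (contDiff_apply ℝ ℝ (1 : Fin 5)).contDiffOn
      refine ContDiffOn.add ?_ (contDiffOn_const.mul (hc.pow 2))
      rcases h with rfl | h
      · simpa using contDiffOn_const
      · refine contDiffOn_const.div (hc.pow 2) fun x hx => pow_ne_zero 2 fun h0 => h ?_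
        exact h0 ▸ (show x 1 ∈ J from hx)) fun _ => rfl)

/-- `φ̃ = φ + lam β / α`. -/
def phiTilde (α β lam φ : ℝ) : ℝ := φ + lam * β / α

/-- `A = (α²/8) (φ̃ - α/4) (φ̃ - 3α/4)`. -/
def coeffA (α β lam φ : ℝ) : ℝ :=
  α ^ 2 / 8 * (phiTilde α β lam φ - α / 4) * (phiTilde α β lam φ - 3 * α / 4)

/-- `B = lam²/8`. -/
def coeffB (lam : ℝ) : ℝ := lam ^ 2 / 8

/-- The potential `V(t,q) = A/q² + B q²` of the one-factor affine model with parameters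
`α, β, lam, φ`. -/
def affinePotential (J : TopologicalSpace.Opens ℝ) (α β lam φ : ℝ)
    (h : coeffA α β lam φ = 0 ∨ (0 : ℝ) ∉ J) : SmoothFn (phaseSpace J) :=
  potential J (coeffA α β lam φ) (coeffB lam) h

end HJB

end

noncomputable section

namespace HJB

variable {M : TopologicalSpace.Opens Coords}

/-! Put γ = E + B²/2 − V. The generators of `I` have degrees one, two and two, so stability of `I`
forces `L_N ω` to be a multiple of ω, and `L_N β` to lie in the span of Ω and β modulo ω. Evaluating
these conditions on vector fields that annihilate ω gives linear equations for the components of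
`N`. Comparing coefficients in E and then in B leaves the system `DeterminingEquations`
(`determiningEquations_of_mem`): all other components are controlled by N^t, N^q and N^S, and N^S
satisfies θ² ∂_S² N^S = ∂_S N^S.

The last equation splits N^S into e^{S/θ²} u(t,q) and an S-free part. The field built from the
S-free part still solves the system (`DeterminingEquations.reduced`), and S-free solutions are
isovectors (`DeterminingEquations.mem_isovectors`). The difference is then an isovector as well and
lies in 𝒥, so the linear equation for u never has to be examined. The sum is direct because e^{S/θ²}
u is S-free only if it vanishes.

In ℋ the system integrates in q: N^q = T'q/2 + l and N^S = m − T''q²/4 − l'q with T, l, m functions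
of t. The remaining equation, multiplied by q³, is a polynomial in q, and its coefficients say T'''
= 8B₀T', l'' = 2B₀l, m' = (θ²/4)T'' and A l = 0 (`DeterminingEquations.eq_symmetryField`, with
converse `determiningEquations_symmetryField`). A does not constrain T, because A/q² is homogeneous
of degree −2 and its two contributions cancel. This gives 3 + 2 + 1 = 6 parameters, and A ≠ 0
removes the two belonging to l. -/

/-! ### Pairing forms with vector fields -/

/-- The component of degree zero of a form. -/
def degZero : Forms M →ₐ[SmoothFn M] SmoothFn M := ExteriorAlgebra.algebraMapInv

theorem degZero_ι (u : OneForm M) : degZero (ExteriorAlgebra.ι (SmoothFn M) u) = 0 := by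
  simp [degZero, ExteriorAlgebra.algebraMapInv]

theorem degZero_fn (f : SmoothFn M) : degZero (fn f) = f := by
  simp [degZero, fn]

/-- Contraction of a form with a vector field, given as a functional on `1`-forms. -/
def contract (X : Module.Dual (SmoothFn M) (OneForm M)) (σ : Forms M) : Forms M :=
  CliffordAlgebra.contractRight (Q := (0 : QuadraticForm (SmoothFn M) (OneForm M))) σ X

theorem contract_mul_ι (X : Module.Dual (SmoothFn M) (OneForm M)) (a : Forms M) (u : OneForm M) :
    contract X (a * ExteriorAlgebra.ι (SmoothFn M) u) =
      X u • a - contract X a * ExteriorAlgebra.ι (SmoothFn M) u :=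
  CliffordAlgebra.contractRight_mul_ι X u a

theorem contract_add (X : Module.Dual (SmoothFn M) (OneForm M)) (a b : Forms M) :
    contract X (a + b) = contract X a + contract X b := by
  simp [contract]

theorem contract_sub (X : Module.Dual (SmoothFn M) (OneForm M)) (a b : Forms M) :
    contract X (a - b) = contract X a - contract X b := by
  simp [contract]

theorem contract_smul (X : Module.Dual (SmoothFn M) (OneForm M)) (f : SmoothFn M) (a : Forms M) :
    contract X (f • a) = f • contract X a := by
  simp [contract]

/-- The value on a vector field of the component of degree one of a form. -/
def pairOne (X : Module.Dual (SmoothFn M) (OneForm M)) (σ : Forms M) : SmoothFn M :=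
  degZero (contract X σ)

/-- The value on two vector fields of the component of degree two of a form. -/
def pairTwo (X Y : Module.Dual (SmoothFn M) (OneForm M)) (σ : Forms M) : SmoothFn M :=
  degZero (contract X (contract Y σ))

theorem pairOne_add (X : Module.Dual (SmoothFn M) (OneForm M)) (a b : Forms M) :
    pairOne X (a + b) = pairOne X a + pairOne X b := by
  simp [pairOne, contract_add]

theorem pairTwo_add (X Y : Module.Dual (SmoothFn M) (OneForm M)) (a b : Forms M) :
    pairTwo X Y (a + b) = pairTwo X Y a + pairTwo X Y b := by
  simp [pairTwo, contract_add]

theorem pairOne_mul_ι (X : Module.Dual (SmoothFn M) (OneForm M)) (a : Forms M) (u : OneForm M) :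
    pairOne X (a * ExteriorAlgebra.ι (SmoothFn M) u) = degZero a * X u := by
  rw [pairOne, contract_mul_ι, map_sub, map_mul, degZero_ι, map_smul, smul_eq_mul]
  ring

theorem pairTwo_mul_ι (X Y : Module.Dual (SmoothFn M) (OneForm M)) (a : Forms M) (u : OneForm M) :
    pairTwo X Y (a * ExteriorAlgebra.ι (SmoothFn M) u) =
      Y u * pairOne X a - X u * pairOne Y a := by
  rw [pairTwo, contract_mul_ι, contract_sub, contract_smul, contract_mul_ι, map_sub, map_sub,
    map_mul, degZero_ι, map_smul, map_smul, smul_eq_mul, smul_eq_mul, pairOne, pairOne]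
  ring

theorem pairTwo_mul_ι_mul_ι (X Y : Module.Dual (SmoothFn M) (OneForm M)) (a : Forms M)
    (u v : OneForm M) :
    pairTwo X Y (a * (ExteriorAlgebra.ι (SmoothFn M) u * ExteriorAlgebra.ι (SmoothFn M) v)) =
      degZero a * (X u * Y v - X v * Y u) := by
  rw [← mul_assoc, pairTwo_mul_ι, pairOne_mul_ι, pairOne_mul_ι]
  ring

theorem pairOne_mul_ι_mul_ι (X : Module.Dual (SmoothFn M) (OneForm M)) (a : Forms M)
    (u v : OneForm M) :
    pairOne X (a * (ExteriorAlgebra.ι (SmoothFn M) u * ExteriorAlgebra.ι (SmoothFn M) v)) = 0 := by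
  rw [← mul_assoc, pairOne_mul_ι, map_mul, degZero_ι, mul_zero, zero_mul]

/-! ### Coordinate calculus -/

theorem pderiv_coord (i j : Fin 5) :
    pderiv i (coord j : SmoothFn M) = if i = j then 1 else 0 := by
  refine SmoothFn.ext fun x => ?_
  rw [pderiv_apply, (extendZero_eventuallyEq (f := (coord j : SmoothFn M).val)
    (g := fun y => y j) (fun y => rfl) x).fderiv_eq,
    (hasFDerivAt_apply (𝕜 := ℝ) j (x : Coords)).fderiv]
  by_cases h : i = j
  · subst h; simp [SmoothFn.one_apply]
  · simp [h, SmoothFn.zero_apply, Ne.symm h]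

theorem pderiv_comm (i j : Fin 5) (f : SmoothFn M) :
    pderiv i (pderiv j f) = pderiv j (pderiv i f) := by
  refine SmoothFn.ext fun x => ?_
  have hx := M.isOpen.mem_nhds x.2
  have hf : ContDiffAt ℝ ∞ (extendZero f.val) x := f.smooth.contDiffAt hx
  have hle : (1 + 1 : WithTop ℕ∞) ≤ ∞ := by
    rw [one_add_one_eq_two]; exact WithTop.coe_le_coe.2 le_top
  have hd : DifferentiableAt ℝ (fderiv ℝ (extendZero f.val)) (x : Coords) :=
    (hf.fderiv_right (m := 1) hle).differentiableAt (by simp)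
  have key (i j : Fin 5) : (pderiv i (pderiv j f)).val x =
      fderiv ℝ (fderiv ℝ (extendZero f.val)) x (Pi.single i 1) (Pi.single j 1) := by
    rw [pderiv_apply, (extendZero_eventuallyEq
      (g := fun y => fderiv ℝ (extendZero f.val) y (Pi.single j 1))
      (fun y => pderiv_apply j f y) x).fderiv_eq]
    rw [fderiv_clm_apply hd (differentiableAt_const _)]
    simp
  rw [key, key]
  refine hf.isSymmSndFDerivAt ?_ _ _
  rw [minSmoothness_of_isRCLikeNormedField]
  exact WithTop.coe_le_coe.2 le_top

theorem act_eq (N : VField M) (f : SmoothFn M) : N.act f = ∑ i, N i * pderiv i f := by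
  unfold VField.act
  rw [← Derivation.coeFnAddMonoidHom_apply, map_sum, Finset.sum_apply]
  rfl

theorem lieOne_diff_coord (N : VField M) (i : Fin 5) : lieOne N (diff (coord i)) = diff (N i) := by
  ext1 j
  have h (j : Fin 5) : N.act (diff (coord i : SmoothFn M) j) = 0 := by
    simp only [diff, pderiv_coord]; split <;> simp
  simp only [lieOne, Pi.add_apply, h, zero_add, Finset.sum_apply, Pi.smul_apply, smul_eq_mul]
  simp [diff, pderiv_coord]

theorem lieDeriv_dx (N : VField M) (i : Fin 5) :
    lieDeriv N (dx i) = ExteriorAlgebra.ι (SmoothFn M) (diff (N i)) := by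
  rw [dx, lieDeriv_ι, lieOne_diff_coord]

theorem lieDeriv_fn (N : VField M) (f : SmoothFn M) : lieDeriv N (fn f) = fn (N.act f) :=
  lieDeriv_algebraMap N f

/-! ### Linear tests for membership in the ideal. -/

/-- The coefficients of `ω`. -/
def coeffω : OneForm M := ![coord 3, coord 4, 1, 0, 0]

theorem formω_eq : (formω : Forms M) = ExteriorAlgebra.ι (SmoothFn M) coeffω := by
  rw [formω, dx, dx, dx, fn, fn, ← ι_smul, ← ι_smul, ← map_add, ← map_add]
  congr 1
  ext1 j
  fin_cases j <;> simp [diff, pderiv_coord, coeffω]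

/-- The coefficient of `dq ∧ dt` in `β`. -/
def coeffβ (V : SmoothFn M) : SmoothFn M := coord 3 + (1 / 2 : ℝ) • coord 4 ^ 2 - V

theorem mem_hjbIdeal {θ : ℝ} {V : SmoothFn M} {σ : Forms M} (h : σ ∈ hjbIdeal θ V) :
    ∃ a b c, σ = a * formω + b * formΩ + c * formβ θ V := by
  obtain ⟨a, b, c, h⟩ := Submodule.mem_span_triple.1 h
  exact ⟨a, b, c, h.symm⟩

/-- `D_t = ∂_t - E ∂_S`; with `D_q`, `∂_E` and `∂_B` it spans the annihilator of `ω`. -/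
def Dt : Module.Dual (SmoothFn M) (OneForm M) :=
  LinearMap.proj 0 - (coord 3 : SmoothFn M) • LinearMap.proj 2

/-- `D_q = ∂_q - B ∂_S`. -/
def Dq : Module.Dual (SmoothFn M) (OneForm M) :=
  LinearMap.proj 1 - (coord 4 : SmoothFn M) • LinearMap.proj 2

/-- Multipliers in the ideal may have mixed degree, but Ω and β have degree two, so the degree-one
part of an element is a function times ω. -/
theorem pairOne_of_mem {θ : ℝ} {V : SmoothFn M} {σ : Forms M} (h : σ ∈ hjbIdeal θ V)
    (X : Module.Dual (SmoothFn M) (OneForm M)) (hX : X coeffω = 0) : pairOne X σ = 0 := by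
  obtain ⟨a, b, c, rfl⟩ := mem_hjbIdeal h
  simp only [formω_eq, formΩ, formβ, dx, mul_add, ← mul_assoc c, pairOne_add,
    pairOne_mul_ι, hX, pairOne_mul_ι_mul_ι]
  simp

/-- The coefficient of dS in ω is 1, so the factor of proportionality between `L_N ω` and ω is read
off at index 2. -/
theorem lieOne_coeffω_of_mem {θ : ℝ} {V : SmoothFn M} {N : VField M} (h : N ∈ isovectors θ V)
    (j : Fin 5) : lieOne N coeffω j = lieOne N coeffω 2 * coeffω j := by
  have hm := h _ (Ideal.subset_span (show formω ∈ ({formω, formΩ, formβ θ V} : Set (Forms M)) by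
    simp))
  rw [formω_eq, lieDeriv_ι] at hm
  have := pairOne_of_mem hm (LinearMap.proj j - (coeffω j : SmoothFn M) • LinearMap.proj 2) (by
    simp [coeffω])
  rw [← one_mul (ExteriorAlgebra.ι _ _), pairOne_mul_ι] at this
  simp at this
  linear_combination this

/-- On the annihilator of ω only Ω and β survive in degree two. Ω takes the value 1 on (∂_E, D_t)
and on (∂_B, D_q); β takes the values γ on (D_q, D_t) and θ²/2 on (∂_B, D_t); both vanish on the
other pairs tested here. -/
theorem pairTwo_of_mem {θ : ℝ} {V : SmoothFn M} {σ : Forms M} (h : σ ∈ hjbIdeal θ V) :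
    pairTwo (LinearMap.proj 3) (LinearMap.proj 4) σ = 0 ∧
    pairTwo (LinearMap.proj 3) Dt σ = pairTwo (LinearMap.proj 4) Dq σ ∧
    algebraMap ℝ (SmoothFn M) (θ ^ 2 / 2) * pairTwo Dq Dt σ =
      coeffβ V * pairTwo (LinearMap.proj 4) Dt σ := by
  obtain ⟨a, b, c, rfl⟩ := mem_hjbIdeal h
  simp only [formω_eq, formΩ, formβ, dx, mul_add, ← mul_assoc c, pairTwo_add,
    pairTwo_mul_ι_mul_ι, pairTwo_mul_ι]
  refine ⟨?_, ?_, ?_⟩ <;> simp [Dt, Dq, coeffω, diff, pderiv_coord, degZero_fn, coeffβ]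
  ring

theorem lieDeriv_formβ (N : VField M) (θ : ℝ) (V : SmoothFn M) : lieDeriv N (formβ θ V) =
    fn (N.act (coeffβ V)) * (dx 1 * dx 0) +
    fn (coeffβ V) * (ExteriorAlgebra.ι _ (diff (N 1)) * dx 0) +
    fn (coeffβ V) * (dx 1 * ExteriorAlgebra.ι _ (diff (N 0))) +
    fn (algebraMap ℝ _ (θ ^ 2 / 2)) * (ExteriorAlgebra.ι _ (diff (N 4)) * dx 0) +
    fn (algebraMap ℝ _ (θ ^ 2 / 2)) * (dx 4 * ExteriorAlgebra.ι _ (diff (N 0))) := by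
  have h0 : fn (0 : SmoothFn M) = 0 := map_zero _
  rw [formβ, ← coeffβ]
  simp only [lieDeriv_add, lieDeriv_mul, lieDeriv_dx, lieDeriv_fn, Derivation.map_algebraMap, h0,
    zero_mul, zero_add, mul_add]
  abel

/-- These are the three tests applied to `L_N β`. Together with the condition on `L_N ω` they yield
all determining equations; `L_N Ω` is not needed in this direction. -/
theorem formβ_relations_of_mem {θ : ℝ} {V : SmoothFn M} {N : VField M}
    (h : N ∈ isovectors θ V) :
    algebraMap ℝ (SmoothFn M) (θ ^ 2 / 2) * pderiv 3 (N 0) = 0 ∧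
    coeffβ V * pderiv 3 (N 1) + algebraMap ℝ _ (θ ^ 2 / 2) * pderiv 3 (N 4) =
      algebraMap ℝ _ (θ ^ 2 / 2) * (pderiv 1 (N 0) - coord 4 * pderiv 2 (N 0)) -
        coeffβ V * pderiv 4 (N 0) ∧
    algebraMap ℝ (SmoothFn M) (θ ^ 2 / 2) * (N.act (coeffβ V) +
      coeffβ V * (pderiv 1 (N 1) - coord 4 * pderiv 2 (N 1)) +
      algebraMap ℝ _ (θ ^ 2 / 2) * (pderiv 1 (N 4) - coord 4 * pderiv 2 (N 4))) =
    coeffβ V * (coeffβ V * pderiv 4 (N 1) + algebraMap ℝ _ (θ ^ 2 / 2) * pderiv 4 (N 4)) := by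
  have hm := h _ (Ideal.subset_span (show formβ θ V ∈
    ({formω, formΩ, formβ θ V} : Set (Forms M)) by simp))
  rw [lieDeriv_formβ] at hm
  obtain ⟨h1, h2, h3⟩ := pairTwo_of_mem hm
  simp only [dx, pairTwo_add, pairTwo_mul_ι_mul_ι, degZero_fn] at h1 h2 h3
  simp [Dt, Dq, diff, pderiv_coord] at h1 h2 h3
  refine ⟨?_, ?_, ?_⟩
  · linear_combination h1
  · linear_combination h2
  · linear_combination h3

/-! ### The determining equations -/

theorem pderiv_mul (i : Fin 5) (f g : SmoothFn M) :
    pderiv i (f * g) = f * pderiv i g + g * pderiv i f := by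
  simp

theorem pderiv_pderiv_eq_zero {j : Fin 5} {f : SmoothFn M} (h : pderiv j f = 0) (i : Fin 5) :
    pderiv j (pderiv i f) = 0 := by
  rw [pderiv_comm, h, map_zero]

/-- Smooth functions can be zero divisors, so equations are divided by nonzero constants only. -/
theorem algebraMap_mul_cancel {r : ℝ} (hr : r ≠ 0) {f : SmoothFn M}
    (h : algebraMap ℝ (SmoothFn M) r * f = 0) : f = 0 := by
  rw [← Algebra.smul_def] at h
  rw [← one_smul ℝ f, ← inv_mul_cancel₀ hr, mul_smul, h, smul_zero]

theorem natCast_mul_cancel {n : ℕ} (hn : n ≠ 0) {f : SmoothFn M} (h : (n : SmoothFn M) * f = 0) :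
    f = 0 :=
  algebraMap_mul_cancel (r := n) (Nat.cast_ne_zero.2 hn) (by rwa [map_natCast])

theorem two_mul_cancel {f : SmoothFn M} (h : 2 * f = 0) : f = 0 :=
  natCast_mul_cancel two_ne_zero (by exact_mod_cast h)

/-- A polynomial in a coordinate whose coefficients do not depend on that coordinate vanishes
only if its coefficients do. -/
theorem coeff_eq_zero_of_sum_coord_pow (i : Fin 5) (n : ℕ) (a : ℕ → SmoothFn M)
    (ha : ∀ k, pderiv i (a k) = 0)
    (h : ∑ k ∈ Finset.range n, (coord i : SmoothFn M) ^ k * a k = 0) (k : ℕ) (hk : k < n) :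
    a k = 0 := by
  induction n generalizing a k with
  | zero => omega
  | succ n ih =>
    -- Differentiation gives a shorter polynomial with coefficients (k + 1) a_{k+1}. The induction
    -- hypothesis kills these, and only a₀ is left in the original sum.
    have h' := congrArg (pderiv i) h
    rw [Finset.sum_range_succ', map_add, map_sum, map_zero] at h'
    have hpos (k : ℕ) (hk : k < n) : a (k + 1) = 0 := by
      refine natCast_mul_cancel (n := k + 1) k.succ_ne_zero
        (ih (fun k => ((k + 1 : ℕ) : SmoothFn M) * a (k + 1)) (fun k => ?_) ?_ k hk)
      · simp [ha]
      · rw [← h', pderiv_mul, ha, pow_zero, mul_zero, pderiv i |>.map_one_eq_zero, mul_zero,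
          add_zero, add_zero]
        refine Finset.sum_congr rfl fun k _ => ?_
        rw [pderiv_mul, ha, Derivation.leibniz_pow, pderiv_coord]
        simp
        ring
    cases k with
    | succ k => exact hpos k (by omega)
    | zero =>
      rw [Finset.sum_range_succ', Finset.sum_eq_zero fun k hk => by
        rw [hpos k (Finset.mem_range.1 hk), mul_zero]] at h
      simpa using h

/-- The determining equations of the isovectors of the Hamilton–Jacobi–Bellman ideal. -/
structure DeterminingEquations (θ : ℝ) (V : SmoothFn M) (N : VField M) : Prop where
  t_q : pderiv 1 (N 0) = 0
  t_S : pderiv 2 (N 0) = 0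
  t_E : pderiv 3 (N 0) = 0
  t_B : pderiv 4 (N 0) = 0
  q_q : 2 * pderiv 1 (N 1) = pderiv 0 (N 0)
  q_S : pderiv 2 (N 1) = 0
  q_E : pderiv 3 (N 1) = 0
  q_B : pderiv 4 (N 1) = 0
  S_E : pderiv 3 (N 2) = 0
  S_B : pderiv 4 (N 2) = 0
  E_eq : N 3 = coord 3 * pderiv 2 (N 2) - coord 3 * pderiv 0 (N 0) - coord 4 * pderiv 0 (N 1) -
    pderiv 0 (N 2)
  B_eq : N 4 = coord 4 * pderiv 2 (N 2) - coord 4 * pderiv 1 (N 1) - pderiv 1 (N 2)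
  S_SS : algebraMap ℝ _ (θ ^ 2) * pderiv 2 (pderiv 2 (N 2)) = pderiv 2 (N 2)
  S_q : algebraMap ℝ _ (θ ^ 2) * pderiv 1 (pderiv 2 (N 2)) = pderiv 0 (N 1) + pderiv 1 (N 2)
  S_t : pderiv 0 (N 2) + pderiv 1 V * N 1 + V * pderiv 0 (N 0) +
    algebraMap ℝ _ (θ ^ 2 / 2) * pderiv 1 (pderiv 1 (N 2)) = V * pderiv 2 (N 2)

theorem lieOne_coeffω (N : VField M) (j : Fin 5) : lieOne N coeffω j =
    N.act (coeffω j) + (coord 3 * pderiv j (N 0) + coord 4 * pderiv j (N 1) + pderiv j (N 2)) := by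
  simp [lieOne, coeffω, Fin.sum_univ_five, diff]

theorem act_coord (N : VField M) (i : Fin 5) : N.act (coord i) = N i := by
  simp [act_eq, pderiv_coord]

theorem pderiv_coeffβ (V : SmoothFn M) (i : Fin 5) : pderiv i (coeffβ V) =
    pderiv i (coord 3) + coord 4 * pderiv i (coord 4) - pderiv i V := by
  rw [coeffβ, map_sub, map_add, Derivation.map_smul, pow_two, pderiv_mul, ← two_mul,
    show (2 : SmoothFn M) = algebraMap ℝ _ 2 from (map_ofNat _ 2).symm, ← Algebra.smul_def,
    smul_smul]
  norm_num

theorem two_mul_coeffβ (V : SmoothFn M) :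
    2 * coeffβ V = 2 * coord 3 + coord 4 ^ 2 - 2 * V := by
  rw [coeffβ, mul_sub, mul_add, mul_smul_comm, two_mul (coord 4 ^ 2),
    ← two_smul ℝ (coord 4 ^ 2 : SmoothFn M), smul_smul]
  norm_num

theorem act_coeffβ (N : VField M) {V : SmoothFn M} (hV : ∀ i, i ≠ 1 → pderiv i V = 0) :
    N.act (coeffβ V) = N 3 + coord 4 * N 4 - N 1 * pderiv 1 V := by
  rw [act_eq]
  simp [pderiv_coeffβ, Fin.sum_univ_five, pderiv_coord, hV]
  ring

/-- Everything follows by differentiating the relations in E and B: γ has slope 1 in E, which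
separates terms with γ from terms without it, and what remains is polynomial in B. -/
theorem determiningEquations_of_mem {θ : ℝ} (hθ : θ ≠ 0) {V : SmoothFn M}
    (hV : ∀ i, i ≠ 1 → pderiv i V = 0) {N : VField M} (h : N ∈ isovectors θ V) :
    DeterminingEquations θ V N := by
  obtain ⟨t_E, r1, r2⟩ := formβ_relations_of_mem h
  have hc0 : θ ^ 2 / 2 ≠ 0 := by positivity
  have e (j : Fin 5) := lieOne_coeffω_of_mem h j
  simp only [lieOne_coeffω] at e
  have e0 := e 0
  have e1 := e 1
  have e3 := e 3
  have e4 := e 4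
  simp [coeffω, act_coord] at e0 e1 e3 e4
  rw [act_coeffβ N hV] at r2
  have hγ (i : Fin 5) := pderiv_coeffβ V i
  set c := algebraMap ℝ (SmoothFn M) (θ ^ 2 / 2) with hc
  have dc (i : Fin 5) : pderiv i c = 0 := by simp [hc]
  have c_cancel {f : SmoothFn M} (h : c * f = 0) : f = 0 := algebraMap_mul_cancel hc0 h
  have t_E := c_cancel t_E
  have dV3 : pderiv 3 V = 0 := hV 3 (by decide)
  have dV4 : pderiv 4 V = 0 := hV 4 (by decide)
  have g3 : pderiv 3 (coeffβ V) = 1 := by simp [hγ, pderiv_coord, dV3]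
  set γ := coeffβ V with hγ'
  set E : SmoothFn M := coord 3 with hE
  set B : SmoothFn M := coord 4 with hB
  have dE1 : pderiv 1 E = 0 := by simp [hE, pderiv_coord]
  have dE2 : pderiv 2 E = 0 := by simp [hE, pderiv_coord]
  have dE3 : pderiv 3 E = 1 := by simp [hE, pderiv_coord]
  have dE4 : pderiv 4 E = 0 := by simp [hE, pderiv_coord]
  have dB1 : pderiv 1 B = 0 := by simp [hB, pderiv_coord]
  have dB2 : pderiv 2 B = 0 := by simp [hB, pderiv_coord]
  have dB3 : pderiv 3 B = 0 := by simp [hB, pderiv_coord]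
  have dB4 : pderiv 4 B = 1 := by simp [hB, pderiv_coord]
  -- `e3` and `e4` are the dE and dB coefficients of `L_N ω`; equality of mixed derivatives is their
  -- compatibility condition.
  have q_E : pderiv 3 (N 1) = pderiv 4 (N 0) := by
    have h3 := congrArg (pderiv 4) e3
    have h4 := congrArg (pderiv 3) e4
    simp only [map_add, pderiv_mul, dE3, dE4, dB3, dB4, map_zero] at h3 h4
    rw [pderiv_comm 4 3, pderiv_comm 4 3, pderiv_comm 4 3] at h3
    linear_combination h3 - h4
  have B_E : pderiv 3 (N 4) = B * pderiv 2 (N 0) - pderiv 1 (N 0) := by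
    have h1 := congrArg (pderiv 3) e1
    have h2 := congrArg (pderiv 1) e3
    have h3 := congrArg (pderiv 2) e3
    simp only [map_add, pderiv_mul, dE1, dE2, dE3, dB1, dB2, dB3, map_zero] at h1 h2 h3
    rw [pderiv_comm 1 3, pderiv_comm 1 3, pderiv_comm 1 3] at h2
    rw [pderiv_comm 2 3, pderiv_comm 2 3, pderiv_comm 2 3] at h3
    linear_combination h1 - h2 + B * h3
  have t_rel : γ * pderiv 4 (N 0) = c * (pderiv 1 (N 0) - B * pderiv 2 (N 0)) := by
    rw [← sub_eq_zero]
    refine two_mul_cancel ?_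
    rw [q_E, B_E] at r1
    linear_combination r1
  -- In `t_rel` only γ depends on E, so the E-derivative isolates ∂_B N^t.
  have t_B : pderiv 4 (N 0) = 0 := by
    have h1 := congrArg (pderiv 3) t_rel
    simp only [pderiv_mul, map_sub, dc, g3, dB3, pderiv_pderiv_eq_zero t_E] at h1
    linear_combination h1
  have t_qS : pderiv 1 (N 0) - B * pderiv 2 (N 0) = 0 := c_cancel (by
    rw [← t_rel, t_B, mul_zero])
  have t_S : pderiv 2 (N 0) = 0 := by
    have h1 := congrArg (pderiv 4) t_qS
    simp only [pderiv_mul, map_sub, dB4, pderiv_pderiv_eq_zero t_B, map_zero] at h1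
    linear_combination -h1
  have t_q : pderiv 1 (N 0) = 0 := by simpa [t_S] using t_qS
  rw [t_B] at q_E
  have S_E : pderiv 3 (N 2) = 0 := by simpa [t_E, q_E] using e3
  rw [t_B, mul_zero, zero_add] at e4
  rw [t_S, mul_zero, zero_add] at e0 e1
  rw [t_q, mul_zero, zero_add] at e1
  rw [t_q, t_S, mul_zero, sub_zero] at B_E
  have E_E : pderiv 3 (N 3) = B * pderiv 2 (N 1) + pderiv 2 (N 2) - pderiv 0 (N 0) := by
    have h1 := congrArg (pderiv 3) e0
    simp only [map_add, pderiv_mul, dE3, dB3, pderiv_pderiv_eq_zero q_E, pderiv_pderiv_eq_zero t_E,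
      pderiv_pderiv_eq_zero S_E] at h1
    linear_combination h1
  -- The left side of `r2` is affine in E, while the right side contains γ² ∂_B N^q. The second
  -- E-derivative therefore gives ∂_B N^q = 0, after which the first one gives `q_rel`.
  have r2' := congrArg (pderiv 3) r2
  simp only [map_add, map_sub, pderiv_mul, dc, dB3, g3, B_E, E_E, pderiv_pderiv_eq_zero q_E,
    pderiv_pderiv_eq_zero B_E, pderiv_pderiv_eq_zero dV3, q_E] at r2'
  have r2'' := congrArg (pderiv 3) r2'
  simp only [map_add, map_sub, map_zero, pderiv_mul, dc, dB3, g3, pderiv_pderiv_eq_zero q_E,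
    pderiv_pderiv_eq_zero B_E, pderiv_pderiv_eq_zero dV3, pderiv_pderiv_eq_zero S_E,
    pderiv_pderiv_eq_zero t_E, pderiv 3 |>.map_one_eq_zero] at r2''
  have q_B : pderiv 4 (N 1) = 0 := two_mul_cancel (by linear_combination -r2'')
  have S_B : pderiv 4 (N 2) = 0 := by simpa [q_B] using e4
  have B_B : pderiv 4 (N 4) = pderiv 2 (N 2) + 2 * B * pderiv 2 (N 1) - pderiv 1 (N 1) := by
    have h1 := congrArg (pderiv 4) e1
    simp only [map_add, pderiv_mul, dB4, pderiv_pderiv_eq_zero q_B,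
      pderiv_pderiv_eq_zero S_B] at h1
    linear_combination h1
  rw [q_B, B_B] at r2'
  have q_rel : 2 * pderiv 1 (N 1) - 2 * B * pderiv 2 (N 1) - pderiv 0 (N 0) = 0 := by
    exact c_cancel (by linear_combination r2')
  have q_S : pderiv 2 (N 1) = 0 := two_mul_cancel (by
    have h1 := congrArg (pderiv 4) q_rel
    simp only [map_sub, pderiv_mul, dB4, pderiv_pderiv_eq_zero q_B, pderiv_pderiv_eq_zero t_B,
      map_zero, show (2 : SmoothFn M) = algebraMap ℝ _ 2 from (map_ofNat _ 2).symm,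
      Derivation.map_algebraMap] at h1
    rw [map_ofNat] at h1
    linear_combination -h1)
  have q_q : 2 * pderiv 1 (N 1) = pderiv 0 (N 0) := by
    rw [q_S] at q_rel
    linear_combination q_rel
  have q_qq : pderiv 1 (pderiv 1 (N 1)) = 0 := two_mul_cancel (by
    have h1 := congrArg (pderiv 1) q_q
    rw [pderiv_pderiv_eq_zero t_q, two_mul, map_add] at h1
    linear_combination h1)
  have E_eq : N 3 = E * pderiv 2 (N 2) - E * pderiv 0 (N 0) - B * pderiv 0 (N 1) -
      pderiv 0 (N 2) := by
    rw [q_S] at e0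
    linear_combination e0
  have B_eq : N 4 = B * pderiv 2 (N 2) - B * pderiv 1 (N 1) - pderiv 1 (N 2) := by
    rw [q_S] at e1
    linear_combination e1
  have B_q : pderiv 1 (N 4) = B * pderiv 1 (pderiv 2 (N 2)) - pderiv 1 (pderiv 1 (N 2)) := by
    rw [B_eq]
    simp only [map_sub, pderiv_mul, dB1, q_qq]
    ring
  have B_S : pderiv 2 (N 4) = B * pderiv 2 (pderiv 2 (N 2)) - pderiv 1 (pderiv 2 (N 2)) := by
    rw [B_eq]
    simp only [map_sub, pderiv_mul, dB2, pderiv_pderiv_eq_zero q_S, pderiv_comm 2 1 (N 2)]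
    ring
  set k := algebraMap ℝ (SmoothFn M) (θ ^ 2) with hk
  have hck : k = 2 * c := by
    rw [hk, hc, show (2 : SmoothFn M) = algebraMap ℝ _ 2 from (map_ofNat _ 2).symm, ← map_mul]
    ring_nf
  have hγ2 : 2 * γ = 2 * E + B ^ 2 - 2 * V := two_mul_coeffβ V
  -- Once N^E and N^B are substituted, E drops out of `r2` and a quadratic polynomial in B remains.
  -- Doubling clears the 1/2 in γ, whence the factors 2 in degrees 0 and 1. The coefficients of
  -- degrees 0, 1, 2 are `S_t`, `S_q`, `S_SS`.
  have poly := coeff_eq_zero_of_sum_coord_pow (4 : Fin 5) 3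
    (fun n => if n = 0 then 2 * (V * pderiv 2 (N 2) - pderiv 0 (N 2) - pderiv 1 V * N 1 -
        V * pderiv 0 (N 0) - c * pderiv 1 (pderiv 1 (N 2)))
      else if n = 1 then 2 * (k * pderiv 1 (pderiv 2 (N 2)) - pderiv 0 (N 1) - pderiv 1 (N 2))
      else pderiv 2 (N 2) - k * pderiv 2 (pderiv 2 (N 2)))
    (fun n => by
      simp only [two_mul]
      split
      · simp only [map_add, map_sub, pderiv_mul, dc, q_B, pderiv_pderiv_eq_zero,
          pderiv_pderiv_eq_zero S_B, dV4, t_B]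
        ring
      split
      · simp [hk, pderiv_pderiv_eq_zero, S_B, q_B]
      · simp [hk, pderiv_pderiv_eq_zero, S_B]) (by
      rw [← hB]
      simp only [Finset.sum_range_succ, Finset.sum_range_zero]
      simp only [one_ne_zero, two_ne_zero, OfNat.ofNat_ne_one, if_true, if_false]
      rw [B_q, B_S, B_B, q_B, q_S] at r2
      refine c_cancel ?_
      rw [E_eq, B_eq] at r2
      linear_combination 2 * r2 + (2 * c * B * pderiv 1 (pderiv 2 (N 2)) -
        c * B ^ 2 * pderiv 2 (pderiv 2 (N 2))) * hck +
        (c * pderiv 2 (N 2) - 2 * c * pderiv 1 (N 1)) * hγ2 - (2 * c * E - 2 * c * V) * q_q)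
  refine ⟨t_q, t_S, t_E, t_B, q_q, q_S, q_E, q_B, S_E, S_B, E_eq, B_eq, ?_, ?_, ?_⟩
  · have := poly 2 (by decide)
    simp at this
    linear_combination -this
  · have := two_mul_cancel (poly 1 (by decide))
    linear_combination this
  · have := two_mul_cancel (poly 0 (by decide))
    linear_combination -this

/-! ### Solutions of the determining equations are isovectors -/

theorem ι_diff (f : SmoothFn M) :
    ExteriorAlgebra.ι (SmoothFn M) (diff f) = ∑ i, pderiv i f • (dx i : Forms M) := by
  simp only [dx, ← map_smul, ← map_sum]
  congr 1
  ext1 j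
  simp [diff, pderiv_coord]

theorem dx_mul_self (i : Fin 5) : (dx i * dx i : Forms M) = 0 :=
  ExteriorAlgebra.ι_sq_zero _

theorem dx_mul_comm (i j : Fin 5) : (dx i * dx j : Forms M) = -(dx j * dx i) :=
  eq_neg_of_add_eq_zero_left (ExteriorAlgebra.ι_add_mul_swap _ _)

theorem fn_mul (f : SmoothFn M) (σ : Forms M) : fn f * σ = f • σ :=
  (Algebra.smul_def f σ).symm

theorem mem_isovectors_of_generators {θ : ℝ} {V : SmoothFn M} {N : VField M}
    (hω : lieDeriv N formω ∈ hjbIdeal θ V) (hΩ : lieDeriv N formΩ ∈ hjbIdeal θ V)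
    (hβ : lieDeriv N (formβ θ V) ∈ hjbIdeal θ V) : N ∈ isovectors θ V := by
  intro η hη
  induction hη using Submodule.span_induction with
  | mem x h =>
    rcases h with rfl | rfl | rfl
    exacts [hω, hΩ, hβ]
  | zero =>
    have h := lieDeriv_add N 0 0
    rw [add_zero, left_eq_add] at h
    rw [h]
    exact zero_mem _
  | add a b _ _ ha hb => rw [lieDeriv_add]; exact add_mem ha hb
  | smul a b hb h =>
    rw [smul_eq_mul, lieDeriv_mul]
    exact add_mem (Ideal.mul_mem_left _ _ hb) (Ideal.mul_mem_left _ _ h)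

/-- With an S-free phase, ω and Ω are invariant under `N`, and β is multiplied by ∂_q N^q. -/
theorem DeterminingEquations.mem_isovectors {θ : ℝ} {V : SmoothFn M}
    (hV : ∀ i, i ≠ 1 → pderiv i V = 0) {N : VField M} (h : DeterminingEquations θ V N)
    (hS : pderiv 2 (N 2) = 0) : N ∈ isovectors θ V := by
  obtain ⟨t_q, t_S, t_E, t_B, q_q, q_S, q_E, q_B, S_E, S_B, E_eq, B_eq, -, S_q, S_t⟩ := h
  rw [hS] at E_eq B_eq S_q S_t
  rw [map_zero, mul_zero] at S_q
  have q_qq : pderiv 1 (pderiv 1 (N 1)) = 0 := two_mul_cancel (by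
    have h1 := congrArg (pderiv 1) q_q
    rw [pderiv_pderiv_eq_zero t_q, two_mul, map_add] at h1
    linear_combination h1)
  have E_q : pderiv 1 (N 3) = pderiv 0 (N 4) := by
    rw [E_eq, B_eq]
    simp [pderiv_coord, pderiv_pderiv_eq_zero t_q, pderiv_comm 1 0]
  have E_S : pderiv 2 (N 3) = 0 := by
    rw [E_eq]
    simp [pderiv_coord, pderiv_pderiv_eq_zero t_S, pderiv_pderiv_eq_zero q_S,
      pderiv_pderiv_eq_zero hS]
  have E_E : pderiv 3 (N 3) = -pderiv 0 (N 0) := by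
    rw [E_eq]
    simp [pderiv_coord, pderiv_pderiv_eq_zero t_E, pderiv_pderiv_eq_zero q_E,
      pderiv_pderiv_eq_zero S_E]
  have E_B : pderiv 4 (N 3) = -pderiv 0 (N 1) := by
    rw [E_eq]
    simp [pderiv_coord, pderiv_pderiv_eq_zero t_B, pderiv_pderiv_eq_zero q_B,
      pderiv_pderiv_eq_zero S_B]
  have B_q : pderiv 1 (N 4) = -pderiv 1 (pderiv 1 (N 2)) := by
    rw [B_eq]
    simp [pderiv_coord, q_qq]
  have B_S : pderiv 2 (N 4) = 0 := by
    rw [B_eq]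
    simp [pderiv_coord, pderiv_pderiv_eq_zero q_S, pderiv_pderiv_eq_zero hS]
  have B_E : pderiv 3 (N 4) = 0 := by
    rw [B_eq]
    simp [pderiv_coord, pderiv_pderiv_eq_zero q_E, pderiv_pderiv_eq_zero S_E]
  have B_B : pderiv 4 (N 4) = -pderiv 1 (N 1) := by
    rw [B_eq]
    simp [pderiv_coord, pderiv_pderiv_eq_zero q_B, pderiv_pderiv_eq_zero S_B]
  have dN0 : ExteriorAlgebra.ι (SmoothFn M) (diff (N 0)) = pderiv 0 (N 0) • (dx 0 : Forms M) := by
    simp [ι_diff, Fin.sum_univ_five, t_q, t_S, t_E, t_B]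
  have dN1 : ExteriorAlgebra.ι (SmoothFn M) (diff (N 1)) =
      pderiv 0 (N 1) • (dx 0 : Forms M) + pderiv 1 (N 1) • (dx 1 : Forms M) := by
    simp [ι_diff, Fin.sum_univ_five, q_S, q_E, q_B]
  have dN3 : ExteriorAlgebra.ι (SmoothFn M) (diff (N 3)) =
      pderiv 0 (N 3) • (dx 0 : Forms M) + pderiv 0 (N 4) • (dx 1 : Forms M) -
        pderiv 0 (N 0) • (dx 3 : Forms M) - pderiv 0 (N 1) • (dx 4 : Forms M) := by
    simp [ι_diff, Fin.sum_univ_five, E_q, E_S, E_E, E_B]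
    abel
  have dN4 : ExteriorAlgebra.ι (SmoothFn M) (diff (N 4)) =
      pderiv 0 (N 4) • (dx 0 : Forms M) - pderiv 1 (pderiv 1 (N 2)) • (dx 1 : Forms M) -
        pderiv 1 (N 1) • (dx 4 : Forms M) := by
    simp [ι_diff, Fin.sum_univ_five, B_q, B_S, B_E, B_B]
    abel
  refine mem_isovectors_of_generators ?_ ?_ ?_
  · have h0 : lieOne N coeffω = 0 := by
      ext1 j
      rw [lieOne_coeffω]
      fin_cases j <;> simp [coeffω, act_coord, E_eq, B_eq, t_q, t_S, t_E, t_B, q_S, q_E, q_B, hS,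
        S_E, S_B]
    rw [formω_eq, lieDeriv_ι, h0, map_zero]
    exact zero_mem _
  · have h0 : lieDeriv N formΩ = 0 := by
      rw [formΩ, lieDeriv_add, lieDeriv_mul, lieDeriv_mul]
      simp only [lieDeriv_dx, dN0, dN1, dN3, dN4, add_mul, sub_mul, mul_add, smul_mul_assoc,
        mul_smul_comm, dx_mul_self, dx_mul_comm 0 1]
      module
    rw [h0]
    exact zero_mem _
  · have h0 : lieDeriv N (formβ θ V) = fn (pderiv 1 (N 1)) * formβ θ V := by
      rw [lieDeriv_formβ, act_coeffβ N hV, formβ, ← coeffβ]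
      simp only [fn_mul, dN0, dN1, dN4, add_mul, sub_mul, smul_mul_assoc, mul_smul_comm,
        dx_mul_self, smul_add]
      set c := algebraMap ℝ (SmoothFn M) (θ ^ 2 / 2)
      -- This value of Nγ is exactly what makes the dq ∧ dt coefficient of `L_N β` equal to γ ∂_q
      -- N^q.
      have h1 : N 3 + coord 4 * N 4 - N 1 * pderiv 1 V =
          c * pderiv 1 (pderiv 1 (N 2)) - coeffβ V * pderiv 0 (N 0) := by
        rw [← sub_eq_zero]
        refine two_mul_cancel ?_
        rw [E_eq, B_eq]
        linear_combination -2 * S_t + 2 * coord 4 * S_q + pderiv 0 (N 0) * two_mul_coeffβ V -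
          coord 4 ^ 2 * q_q
      rw [h1, ← q_q]
      module
    rw [h0]
    exact Ideal.mul_mem_left _ _ (Ideal.subset_span (by simp))

/-! ### Solving the determining equations -/

/-- Where the coordinate vanishes, differentiating the product still gives f = 0. This permits
division by q even when 0 ∈ J. -/
theorem coord_mul_cancel (i : Fin 5) {f : SmoothFn M} (h : coord i * f = 0) : f = 0 := by
  refine SmoothFn.ext fun x => ?_
  have h0 := congrArg (SmoothFn.val · x) h
  have h1 := congrArg (SmoothFn.val · x) (congrArg (pderiv i) h)
  simp only [pderiv_mul, pderiv_coord, if_true, mul_one, map_zero, SmoothFn.add_apply,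
    SmoothFn.mul_apply, SmoothFn.zero_apply, coord_apply] at h0 h1 ⊢
  rcases mul_eq_zero.1 h0 with h | h
  · simpa [h] using h1
  · exact h

/-- Functions of the time only. -/
def IsTimeFn (f : SmoothFn M) : Prop := ∀ i, i ≠ 0 → pderiv i f = 0

theorem IsTimeFn.pderiv_zero {f : SmoothFn M} (h : IsTimeFn f) : IsTimeFn (pderiv 0 f) :=
  fun i hi => pderiv_pderiv_eq_zero (h i hi) 0

theorem IsTimeFn.add {f g : SmoothFn M} (hf : IsTimeFn f) (hg : IsTimeFn g) : IsTimeFn (f + g) :=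
  fun i hi => by rw [map_add, hf i hi, hg i hi, add_zero]

theorem IsTimeFn.mul {f g : SmoothFn M} (hf : IsTimeFn f) (hg : IsTimeFn g) : IsTimeFn (f * g) :=
  fun i hi => by rw [pderiv_mul, hf i hi, hg i hi, mul_zero, mul_zero, add_zero]

theorem IsTimeFn.smul (r : ℝ) {f : SmoothFn M} (hf : IsTimeFn f) : IsTimeFn (r • f) :=
  fun i hi => by rw [Derivation.map_smul, hf i hi, smul_zero]

theorem isTimeFn_algebraMap (r : ℝ) : IsTimeFn (algebraMap ℝ (SmoothFn M) r) :=
  fun _ _ => Derivation.map_algebraMap _ r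

variable (M) in
/-- The constant function `1 / 2`. -/
def half : SmoothFn M := algebraMap ℝ _ (1 / 2)

theorem two_mul_half : (2 : SmoothFn M) * half M = 1 := by
  unfold half
  rw [show (2 : SmoothFn M) = algebraMap ℝ _ 2 from (map_ofNat _ 2).symm, ← map_mul]
  norm_num

theorem pderiv_half (i : Fin 5) : pderiv i (half M) = 0 :=
  Derivation.map_algebraMap _ _

/-- The phase component `N^S` of a vector field that preserves `ω`. -/
def phase (T l m : SmoothFn M) : SmoothFn M :=
  m - half M ^ 2 * pderiv 0 (pderiv 0 T) * coord 1 ^ 2 - pderiv 0 l * coord 1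

/-- The component `N^q` of a vector field that preserves `ω`. -/
def shift (T l : SmoothFn M) : SmoothFn M := half M * pderiv 0 T * coord 1 + l

/-- The isovectors in the canonical supplement, in terms of three functions of the time. -/
def symmetryField (T l m : SmoothFn M) : VField M :=
  ![T, shift T l, phase T l m,
    -(coord 3 * pderiv 0 T) - coord 4 * pderiv 0 (shift T l) - pderiv 0 (phase T l m),
    -(coord 4 * pderiv 1 (shift T l)) - pderiv 1 (phase T l m)]

/-- The potential enters only through q²V = a + bq⁴. With denominators cleared, the case a = 0 with
0 ∈ J needs no separate treatment. -/
theorem coord_pow_three_mul_pderiv {V : SmoothFn M} {a b : ℝ}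
    (hV : coord 1 ^ 2 * V = algebraMap ℝ _ a + algebraMap ℝ _ b * coord 1 ^ 4) :
    coord 1 ^ 3 * pderiv 1 V = 2 * algebraMap ℝ _ b * coord 1 ^ 4 - 2 * algebraMap ℝ _ a := by
  have h := congrArg (pderiv 1) hV
  simp [pderiv_coord] at h
  linear_combination coord 1 * h - 2 * hV

theorem pderiv_potential {V : SmoothFn M} {a b : ℝ}
    (hV : coord 1 ^ 2 * V = algebraMap ℝ _ a + algebraMap ℝ _ b * coord 1 ^ 4) (i : Fin 5)
    (hi : i ≠ 1) : pderiv i V = 0 := by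
  have h := congrArg (pderiv i) hV
  simp [pderiv_coord, hi] at h
  exact coord_mul_cancel 1 (coord_mul_cancel 1 (by linear_combination h))

theorem pderiv_shift {T l : SmoothFn M} (hT : IsTimeFn T) (hl : IsTimeFn l) :
    pderiv 0 (shift T l) = half M * pderiv 0 (pderiv 0 T) * coord 1 + pderiv 0 l ∧
    pderiv 1 (shift T l) = half M * pderiv 0 T ∧
    pderiv 2 (shift T l) = 0 ∧ pderiv 3 (shift T l) = 0 ∧ pderiv 4 (shift T l) = 0 := by
  have hT' := hT.pderiv_zero
  refine ⟨?_, ?_, ?_, ?_, ?_⟩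
  · simp only [shift, map_add, pderiv_mul, pderiv_half, pderiv_coord]
    simp
    ring
  all_goals
    simp only [shift, map_add, pderiv_mul, pderiv_half, pderiv_coord,
      hT' _ (by decide : (1 : Fin 5) ≠ 0), hT' _ (by decide : (2 : Fin 5) ≠ 0),
      hT' _ (by decide : (3 : Fin 5) ≠ 0), hT' _ (by decide : (4 : Fin 5) ≠ 0),
      hl _ (by decide : (1 : Fin 5) ≠ 0), hl _ (by decide : (2 : Fin 5) ≠ 0),
      hl _ (by decide : (3 : Fin 5) ≠ 0), hl _ (by decide : (4 : Fin 5) ≠ 0)]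
    simp

theorem pderiv_phase {T l m : SmoothFn M} (hT : IsTimeFn T) (hl : IsTimeFn l) (hm : IsTimeFn m) :
    pderiv 0 (phase T l m) = phase (pderiv 0 T) (pderiv 0 l) (pderiv 0 m) ∧
    pderiv 1 (phase T l m) =
      -(half M * pderiv 0 (pderiv 0 T) * coord 1) - pderiv 0 l ∧
    pderiv 2 (phase T l m) = 0 ∧ pderiv 3 (phase T l m) = 0 ∧ pderiv 4 (phase T l m) = 0 := by
  have hT' := hT.pderiv_zero.pderiv_zero
  have hl' := hl.pderiv_zero
  refine ⟨?_, ?_, ?_, ?_, ?_⟩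
  · simp only [phase, map_sub, pow_two, pderiv_mul, pderiv_half, pderiv_coord]
    simp
    ring
  all_goals
    simp only [phase, map_sub, pow_two, pderiv_mul, pderiv_half, pderiv_coord,
      hT' _ (by decide : (1 : Fin 5) ≠ 0), hT' _ (by decide : (2 : Fin 5) ≠ 0),
      hT' _ (by decide : (3 : Fin 5) ≠ 0), hT' _ (by decide : (4 : Fin 5) ≠ 0),
      hl' _ (by decide : (1 : Fin 5) ≠ 0), hl' _ (by decide : (2 : Fin 5) ≠ 0),
      hl' _ (by decide : (3 : Fin 5) ≠ 0), hl' _ (by decide : (4 : Fin 5) ≠ 0),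
      hm _ (by decide : (1 : Fin 5) ≠ 0), hm _ (by decide : (2 : Fin 5) ≠ 0),
      hm _ (by decide : (3 : Fin 5) ≠ 0), hm _ (by decide : (4 : Fin 5) ≠ 0)]
    simp
  linear_combination (half M * pderiv 0 (pderiv 0 T) * coord 1) *
    two_mul_half (M := M)

theorem determiningEquations_symmetryField {θ : ℝ} {V : SmoothFn M} {a b : ℝ}
    (hV : coord 1 ^ 2 * V = algebraMap ℝ _ a + algebraMap ℝ _ b * coord 1 ^ 4)
    {T l m : SmoothFn M} (hT : IsTimeFn T) (hl : IsTimeFn l) (hm : IsTimeFn m)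
    (eT : pderiv 0 (pderiv 0 (pderiv 0 T)) = 8 * algebraMap ℝ _ b * pderiv 0 T)
    (el : pderiv 0 (pderiv 0 l) = 2 * algebraMap ℝ _ b * l)
    (em : pderiv 0 m = algebraMap ℝ _ (θ ^ 2 / 2) * half M * pderiv 0 (pderiv 0 T))
    (ha : algebraMap ℝ _ a * l = 0) : DeterminingEquations θ V (symmetryField T l m) := by
  obtain ⟨q0, q1, q2, q3, q4⟩ := pderiv_shift hT hl
  obtain ⟨p0, p1, p2, p3, p4⟩ := pderiv_phase hT hl hm
  have h2 := two_mul_half (M := M)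
  have e2 : symmetryField T l m 2 = phase T l m := rfl
  have e1 : symmetryField T l m 1 = shift T l := rfl
  have e0 : symmetryField T l m 0 = T := rfl
  refine ⟨hT 1 (by decide), hT 2 (by decide), hT 3 (by decide), hT 4 (by decide), ?_, q2, q3, q4,
    p3, p4, ?_, ?_, ?_, ?_, ?_⟩
  · rw [e1, e0, q1]
    linear_combination pderiv 0 T * h2
  · rw [e2, p2, e0, e1]
    change -(coord 3 * pderiv 0 T) - coord 4 * pderiv 0 (shift T l) - pderiv 0 (phase T l m) = _
    ring
  · rw [e2, p2, e1]
    change -(coord 4 * pderiv 1 (shift T l)) - pderiv 1 (phase T l m) = _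
    ring
  · rw [e2, p2, map_zero, mul_zero]
  · rw [e2, p2, map_zero, mul_zero, e1, q0, p1]
    ring
  · have pqq : pderiv 1 (pderiv 1 (phase T l m)) =
        -(half M * pderiv 0 (pderiv 0 T)) := by
      simp only [p1, map_sub, map_neg, pderiv_mul, pderiv_half, pderiv_coord,
        hT.pderiv_zero.pderiv_zero 1 (by decide), hl.pderiv_zero 1 (by decide)]
      simp
    rw [e2, p2, e1, e0, mul_zero, pqq, p0, phase, eT, el, em]
    -- Multiplication by q³ turns V and V' into polynomials in q.
    refine coord_mul_cancel 1 (coord_mul_cancel 1 (coord_mul_cancel 1 ?_))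
    have h3 := coord_pow_three_mul_pderiv hV
    rw [shift]
    set r := half M
    linear_combination (r * pderiv 0 T * coord 1 + l) * h3 + pderiv 0 T * coord 1 * hV - 2 * ha
      + (coord 1 ^ 5 * algebraMap ℝ _ b * pderiv 0 T * (-1 - 4 * r) -
        coord 1 * pderiv 0 T * algebraMap ℝ _ a) * h2

theorem DeterminingEquations.eq_symmetryField {θ : ℝ} {V : SmoothFn M} {a b : ℝ}
    (hV : coord 1 ^ 2 * V = algebraMap ℝ _ a + algebraMap ℝ _ b * coord 1 ^ 4) {N : VField M}
    (h : DeterminingEquations θ V N) (hS : pderiv 2 (N 2) = 0) :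
    ∃ T l m : SmoothFn M, IsTimeFn T ∧ IsTimeFn l ∧ IsTimeFn m ∧
      pderiv 0 (pderiv 0 (pderiv 0 T)) = 8 * algebraMap ℝ _ b * pderiv 0 T ∧
      pderiv 0 (pderiv 0 l) = 2 * algebraMap ℝ _ b * l ∧
      pderiv 0 m =
        algebraMap ℝ _ (θ ^ 2 / 2) * half M * pderiv 0 (pderiv 0 T) ∧
      algebraMap ℝ _ a * l = 0 ∧ N = symmetryField T l m := by
  obtain ⟨t_q, t_S, t_E, t_B, q_q, q_S, q_E, q_B, S_E, S_B, E_eq, B_eq, -, S_q, S_t⟩ := h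
  rw [hS] at E_eq B_eq S_q S_t
  rw [map_zero, mul_zero] at S_q
  have h2 := two_mul_half (M := M)
  have h3 := coord_pow_three_mul_pderiv hV
  have hT : IsTimeFn (N 0) := by
    intro i hi
    fin_cases i
    exacts [absurd rfl hi, t_q, t_S, t_E, t_B]
  obtain ⟨T, hT0⟩ : ∃ T, T = N 0 := ⟨_, rfl⟩
  rw [← hT0] at hT
  have hT' := hT.pderiv_zero
  have hT'' := hT'.pderiv_zero
  -- The slope T'/2 of N^q in q is forced by `q_q`, so the remainder depends on t only.
  obtain ⟨l, hl0⟩ : ∃ l, l = N 1 - half M * pderiv 0 T * coord 1 := ⟨_, rfl⟩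
  have hl : IsTimeFn l := by
    intro i hi
    rw [hl0, map_sub, pderiv_mul, pderiv_mul, hT' i hi, pderiv_half, pderiv_coord]
    fin_cases i
    · exact absurd rfl hi
    · simp
      refine two_mul_cancel ?_
      rw [mul_sub, q_q, ← hT0]
      linear_combination -pderiv 0 T * h2
    · simp [q_S]
    · simp [q_E]
    · simp [q_B]
  have hl' := hl.pderiv_zero
  have e1 : N 1 = shift T l := by rw [shift, hl0]; ring
  obtain ⟨q0, q1, -⟩ := pderiv_shift hT hl
  -- For an S-free phase `S_q` reads ∂_q N^S = −∂_t N^q; integrating in q gives the subtracted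
  -- terms, and m is the constant of integration.
  obtain ⟨m, hm0⟩ : ∃ m, m = N 2 + half M ^ 2 * pderiv 0 (pderiv 0 T) *
    coord 1 ^ 2 + pderiv 0 l * coord 1 := ⟨_, rfl⟩
  have hm : IsTimeFn m := by
    intro i hi
    rw [hm0]
    simp only [map_add, pow_two, pderiv_mul, hT'' i hi, hl' i hi, pderiv_half,
      pderiv_coord]
    fin_cases i
    · exact absurd rfl hi
    · simp
      rw [e1, q0] at S_q
      linear_combination -S_q + (half M * pderiv 0 (pderiv 0 T) *
        coord 1) * h2
    · simp [hS]
    · simp [S_E]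
    · simp [S_B]
  have e2 : N 2 = phase T l m := by rw [phase, hm0]; ring
  obtain ⟨p0, p1, -⟩ := pderiv_phase hT hl hm
  have pqq : pderiv 1 (pderiv 1 (phase T l m)) =
      -(half M * pderiv 0 (pderiv 0 T)) := by
    simp only [p1, map_sub, map_neg, pderiv_mul, pderiv_half, pderiv_coord,
      hT'' 1 (by decide), hl' 1 (by decide)]
    simp
  rw [e2, e1, ← hT0, pqq, p0, phase, shift] at S_t
  -- These are the coefficients of q³ times `S_t`. In degree 1 the terms −aT' from V'N^q and aT'
  -- from VT' cancel, which is why a restricts l alone.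
  have poly := coeff_eq_zero_of_sum_coord_pow (1 : Fin 5) 6 (fun n =>
      if n = 0 then -2 * (algebraMap ℝ _ a * l)
      else if n = 3 then pderiv 0 m -
        algebraMap ℝ _ (θ ^ 2 / 2) * (half M * pderiv 0 (pderiv 0 T))
      else if n = 4 then 2 * (algebraMap ℝ _ b * l) - pderiv 0 (pderiv 0 l)
      else if n = 5 then 2 * (algebraMap ℝ _ b * pderiv 0 T) -
        half M ^ 2 * pderiv 0 (pderiv 0 (pderiv 0 T))
      else 0) (fun n => by
    simp only [neg_mul, two_mul, pow_two]
    split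
    · simp [hl 1 (by decide)]
    split
    · simp [hm.pderiv_zero 1 (by decide), hT'' 1 (by decide), pderiv_half]
    split
    · simp [hl 1 (by decide), hl'.pderiv_zero 1 (by decide)]
    split
    · simp [hT' 1 (by decide), hT''.pderiv_zero 1 (by decide), pderiv_half]
    · simp) (by
    simp only [Finset.sum_range_succ, Finset.sum_range_zero]
    simp
    linear_combination coord 1 ^ 3 * S_t - (half M * pderiv 0 T * coord 1 + l) * h3 -
      pderiv 0 T * coord 1 * hV -
      (coord 1 ^ 5 * algebraMap ℝ _ b * pderiv 0 T - algebraMap ℝ _ a * pderiv 0 T * coord 1) * h2)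
  have w0 := poly 0 (by decide)
  have w3 := poly 3 (by decide)
  have w4 := poly 4 (by decide)
  have w5 := poly 5 (by decide)
  simp at w0 w3 w4 w5
  refine ⟨T, l, m, hT, hl, hm, ?_, ?_, ?_, ?_, ?_⟩
  · linear_combination -4 * w5 - pderiv 0 (pderiv 0 (pderiv 0 T)) * (1 + 2 * half M) * h2
  · linear_combination -w4
  · linear_combination w3
  · exact two_mul_cancel w0
  · ext1 i
    fin_cases i
    · exact hT0.symm
    · exact e1
    · exact e2
    · refine E_eq.trans ?_
      rw [e1, e2, ← hT0]
      change _ = -(coord 3 * pderiv 0 T) - coord 4 * pderiv 0 (shift T l) - pderiv 0 (phase T l m)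
      ring
    · refine B_eq.trans ?_
      rw [e1, e2]
      change _ = -(coord 4 * pderiv 1 (shift T l)) - pderiv 1 (phase T l m)
      ring

/-! ### Functions with vanishing partial derivatives -/

/-- Along the segment from x to y only the coordinates that change contribute to the derivative.
Restricting the hypothesis to those lets the lemma serve for constants, for S-free functions and for
functions of (t, q). -/
theorem val_eq_of_pderiv_eq_zero (hM : Convex ℝ (M : Set Coords)) (f : SmoothFn M) (x y : M)
    (h : ∀ i, x.1 i ≠ y.1 i → pderiv i f = 0) : f.val x = f.val y := by
  set L : ℝ → Coords := fun s => x.1 + s • (y.1 - x.1) with hL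
  have hmem (s : ℝ) (hs : s ∈ Set.Icc (0 : ℝ) 1) : L s ∈ M :=
    hM.add_smul_sub_mem x.2 y.2 hs
  have hd (s : ℝ) (hs : s ∈ Set.Icc (0 : ℝ) 1) :
      HasDerivAt (fun s => extendZero f.val (L s)) 0 s := by
    have hLd : HasDerivAt L (y.1 - x.1) s := by
      have h1 := ((hasDerivAt_id s).smul_const (y.1 - x.1)).const_add x.1
      rwa [one_smul] at h1
    have hf := (differentiableAt_extendZero f ⟨L s, hmem s hs⟩).hasFDerivAt
    have h2 := hf.comp_hasDerivAt s hLd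
    suffices e0 : fderiv ℝ (extendZero f.val) (L s) (y.1 - x.1) = 0 by
      rw [← e0]; exact h2
    rw [pi_eq_sum_univ' (y.1 - x.1), map_sum, Finset.sum_eq_zero]
    intro i _
    rw [map_smul]
    by_cases hi : x.1 i = y.1 i
    · simp [hi]
    · have h' : fderiv ℝ (extendZero f.val) (L s) (Pi.single i 1) = 0 := by
        refine (pderiv_apply i f ⟨L s, hmem s hs⟩).symm.trans ?_
        rw [h i hi]
        rfl
      exact (congrArg ((y.1 - x.1) i • ·) h').trans (smul_zero _)
  have hc := constant_of_has_deriv_right_zero (f := fun s => extendZero f.val (L s)) (a := 0)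
    (b := 1) (fun s hs => (hd s hs).continuousAt.continuousWithinAt)
    (fun s hs => (hd s ⟨hs.1, hs.2.le⟩).hasDerivWithinAt) 1 (by simp)
  simpa [hL, extendZero_apply] using hc.symm

theorem algebraMap_apply (r : ℝ) (x : M) : (algebraMap ℝ (SmoothFn M) r).val x = r := rfl

theorem eq_algebraMap_of_pderiv_eq_zero (hM : Convex ℝ (M : Set Coords)) (x : M) (f : SmoothFn M)
    (h : ∀ i, pderiv i f = 0) : f = algebraMap ℝ _ (f.val x) :=
  SmoothFn.ext fun y => val_eq_of_pderiv_eq_zero hM f y x fun i _ => h i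

/-! ### Functions of one coordinate -/

/-- A smooth function of one coordinate. -/
def ofCoord (i : Fin 5) (g : ℝ → ℝ) (hg : ContDiff ℝ ∞ g) : SmoothFn M :=
  SmoothFn.mk (fun x => g (x.1 i)) (contDiffOn_extendZero (g := fun x => g (x i))
    (hg.comp (contDiff_apply ℝ ℝ i)).contDiffOn fun _ => rfl)

theorem ofCoord_apply (i : Fin 5) (g : ℝ → ℝ) (hg : ContDiff ℝ ∞ g) (x : M) :
    (ofCoord i g hg : SmoothFn M).val x = g (x.1 i) := rfl

theorem pderiv_ofCoord_apply (i j : Fin 5) {g : ℝ → ℝ} (hg : ContDiff ℝ ∞ g) {g' : ℝ → ℝ}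
    (hg' : ∀ s, HasDerivAt g (g' s) s) (x : M) :
    (pderiv j (ofCoord i g hg : SmoothFn M)).val x = if j = i then g' (x.1 i) else 0 := by
  have h : HasFDerivAt (fun y : Coords => g (y i))
      (g' (x.1 i) • (ContinuousLinearMap.proj i : Coords →L[ℝ] ℝ)) x.1 :=
    (hg' (x.1 i)).comp_hasFDerivAt x.1 (hasFDerivAt_apply (𝕜 := ℝ) i x.1)
  rw [pderiv_apply, (extendZero_eventuallyEq (f := (ofCoord i g hg : SmoothFn M).val)
    (g := fun y => g (y i)) (fun y => rfl) x).fderiv_eq, h.fderiv]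
  by_cases hij : j = i
  · subst hij; simp
  · simp [hij, Ne.symm hij]

/-! ### Fundamental solutions in time. -/

variable (M) in
/-- `cosh (μ t)`. -/
def coshTime (μ : ℝ) : SmoothFn M :=
  ofCoord 0 (fun t => Real.cosh (μ * t)) (Real.contDiff_cosh.comp (contDiff_const.mul contDiff_id))

variable (M) in
/-- `sinh (μ t)`. -/
def sinhTimeAux (μ : ℝ) : SmoothFn M :=
  ofCoord 0 (fun t => Real.sinh (μ * t)) (Real.contDiff_sinh.comp (contDiff_const.mul contDiff_id))

variable (M) in
/-- `sinh (μ t) / μ`, which is read as `t` if `μ = 0`. -/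
def sinhTime (μ : ℝ) : SmoothFn M := if μ = 0 then coord 0 else μ⁻¹ • sinhTimeAux M μ

variable (M) in
/-- `(cosh (μ t) - 1) / μ²`, which is read as `t² / 2` if `μ = 0`. -/
def primTime (μ : ℝ) : SmoothFn M :=
  if μ = 0 then half M * coord 0 ^ 2 else (μ ^ 2)⁻¹ • (coshTime M μ - 1)

theorem pderiv_coshTime_aux (μ : ℝ) (j : Fin 5) :
    pderiv j (coshTime M μ) = if j = 0 then μ • sinhTimeAux M μ else 0 := by
  refine SmoothFn.ext fun x => ?_
  rw [coshTime, pderiv_ofCoord_apply 0 j _ (g' := fun t => Real.sinh (μ * t) * (μ * 1))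
    (fun s => by simpa using ((hasDerivAt_id s).const_mul μ).cosh)]
  split
  · rw [SmoothFn.smul_apply, sinhTimeAux, ofCoord_apply]; ring
  · rfl

theorem pderiv_sinhTimeAux (μ : ℝ) (j : Fin 5) :
    pderiv j (sinhTimeAux M μ) = if j = 0 then μ • coshTime M μ else 0 := by
  refine SmoothFn.ext fun x => ?_
  rw [sinhTimeAux, pderiv_ofCoord_apply 0 j _ (g' := fun t => Real.cosh (μ * t) * (μ * 1))
    (fun s => by simpa using ((hasDerivAt_id s).const_mul μ).sinh)]
  split
  · rw [SmoothFn.smul_apply, coshTime, ofCoord_apply]; ring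
  · rfl

theorem isTimeFn_coshTime (μ : ℝ) : IsTimeFn (coshTime M μ) := fun i hi => by
  rw [pderiv_coshTime_aux, if_neg hi]

theorem isTimeFn_sinhTime (μ : ℝ) : IsTimeFn (sinhTime M μ) := fun i hi => by
  rw [sinhTime]
  split
  · simp [pderiv_coord, hi]
  · simp [pderiv_sinhTimeAux, hi]

theorem coshTime_zero : coshTime M 0 = 1 := SmoothFn.ext fun x => by
  simp [coshTime, ofCoord_apply, SmoothFn.one_apply]

/-- Dividing sinh(μt) by μ makes the derivative rules hold at μ = 0 too, so a vanishing frequency is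
no exception later. -/
theorem pderiv_coshTime (μ : ℝ) :
    pderiv 0 (coshTime M μ) = algebraMap ℝ _ (μ ^ 2) * sinhTime M μ := by
  rw [sinhTime]
  split_ifs with h
  · subst h; simp [coshTime_zero]
  · rw [pderiv_coshTime_aux, if_pos rfl, ← Algebra.smul_def, smul_smul]
    congr 1; field_simp

theorem pderiv_sinhTime (μ : ℝ) : pderiv 0 (sinhTime M μ) = coshTime M μ := by
  rw [sinhTime]
  split_ifs with h
  · subst h; simp [coshTime_zero, pderiv_coord]
  · simp [pderiv_sinhTimeAux, smul_smul, h]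

theorem isTimeFn_primTime (μ : ℝ) : IsTimeFn (primTime M μ) := fun i hi => by
  rw [primTime]
  split
  · simp [pderiv_coord, hi, pderiv_half]
  · simp [isTimeFn_coshTime μ i hi]

theorem pderiv_primTime (μ : ℝ) : pderiv 0 (primTime M μ) = sinhTime M μ := by
  rw [primTime]
  split_ifs with h
  · subst h
    rw [pow_two, pderiv_mul, pderiv_mul, pderiv_half, pderiv_coord, if_pos rfl, sinhTime,
      if_pos rfl]
    linear_combination coord 0 * two_mul_half (M := M)
  · rw [Derivation.map_smul, map_sub, pderiv_coshTime, ← Algebra.smul_def]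
    simp [smul_smul, h]

/-- This is the Wronskian of the two fundamental solutions. -/
theorem coshTime_sq_sub (μ : ℝ) :
    coshTime M μ ^ 2 - algebraMap ℝ _ (μ ^ 2) * sinhTime M μ ^ 2 = 1 := by
  rw [sinhTime]
  split_ifs with h
  · subst h; simp [coshTime_zero]
  · refine SmoothFn.ext fun x => ?_
    have e : algebraMap ℝ (SmoothFn M) (μ ^ 2) * (μ⁻¹ • sinhTimeAux M μ) ^ 2 =
        sinhTimeAux M μ ^ 2 := by
      rw [smul_pow, ← Algebra.smul_def, smul_smul]
      simp [h]
    rw [e]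
    exact Real.cosh_sq_sub_sinh_sq (μ * x.1 0)

theorem coshTime_apply {x : M} (hx : x.1 0 = 0) (μ : ℝ) : (coshTime M μ).val x = 1 := by
  simp [coshTime, ofCoord_apply, hx]

theorem sinhTime_apply {x : M} (hx : x.1 0 = 0) (μ : ℝ) : (sinhTime M μ).val x = 0 := by
  rw [sinhTime]
  split
  · exact hx
  · simp [SmoothFn.smul_apply, sinhTimeAux, ofCoord_apply, hx]

/-- The solutions of `f'' = μ² f`. -/
theorem IsTimeFn.eq_of_second_order (hM : Convex ℝ (M : Set Coords)) (x : M) {f : SmoothFn M}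
    (hf : IsTimeFn f) {μ : ℝ} (h : pderiv 0 (pderiv 0 f) = algebraMap ℝ _ (μ ^ 2) * f) :
    ∃ c d : ℝ, f = c • coshTime M μ + d • sinhTime M μ := by
  have hf' := hf.pderiv_zero
  have hC := isTimeFn_coshTime (M := M) μ
  have hS := isTimeFn_sinhTime (M := M) μ
  -- With C and S the fundamental solutions, fC − f'S and f'C − μ²fS are first integrals. They are
  -- the coefficients c and d, since C² − μ²S² = 1 solves them for f.
  have h1 := eq_algebraMap_of_pderiv_eq_zero hM x
    (f * coshTime M μ - pderiv 0 f * sinhTime M μ) (fun i => by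
      rw [map_sub, pderiv_mul, pderiv_mul]
      by_cases hi : i = 0
      · subst hi
        rw [h, pderiv_coshTime, pderiv_sinhTime]; ring
      · rw [hC i hi, hS i hi, hf' i hi, hf i hi]; ring)
  have h2 := eq_algebraMap_of_pderiv_eq_zero hM x
    (pderiv 0 f * coshTime M μ - algebraMap ℝ _ (μ ^ 2) * (f * sinhTime M μ)) (fun i => by
      rw [map_sub, pderiv_mul, pderiv_mul, pderiv_mul, Derivation.map_algebraMap]
      by_cases hi : i = 0
      · subst hi
        rw [h, pderiv_coshTime, pderiv_sinhTime]; ring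
      · rw [hC i hi, hS i hi, hf' i hi, hf i hi]; ring)
  refine ⟨(f * coshTime M μ - pderiv 0 f * sinhTime M μ).val x,
    (pderiv 0 f * coshTime M μ - algebraMap ℝ _ (μ ^ 2) * (f * sinhTime M μ)).val x, ?_⟩
  rw [Algebra.smul_def, Algebra.smul_def, ← h1, ← h2]
  linear_combination -f * coshTime_sq_sub (M := M) μ

/-- Functions of the time with equal derivatives differ by a constant. -/
theorem IsTimeFn.eq_add_of_pderiv_eq (hM : Convex ℝ (M : Set Coords)) (x : M) {f g : SmoothFn M}
    (hf : IsTimeFn f) (hg : IsTimeFn g) (h : pderiv 0 f = pderiv 0 g) :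
    ∃ c : ℝ, f = algebraMap ℝ _ c + g := by
  refine ⟨_, eq_add_of_sub_eq (eq_algebraMap_of_pderiv_eq_zero hM x (f - g) fun i => ?_)⟩
  rw [map_sub]
  by_cases hi : i = 0
  · rw [hi, h, sub_self]
  · rw [hf i hi, hg i hi, sub_self]

/-! ### Splitting off the superposition fields -/

/-- The part of a vector field whose phase does not depend on `S`. -/
def reduced (θ : ℝ) (N : VField M) : VField M :=
  let p := N 2 - algebraMap ℝ _ (θ ^ 2) * pderiv 2 (N 2)
  ![N 0, N 1, p, -(coord 3 * pderiv 0 (N 0)) - coord 4 * pderiv 0 (N 1) - pderiv 0 p,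
    -(coord 4 * pderiv 1 (N 1)) - pderiv 1 p]

/-- The operator 1 − θ²∂_S removes the e^{S/θ²} part of the phase by `S_SS`. It commutes with the
other derivatives, and V and N^q are S-free, so the equations persist. -/
theorem DeterminingEquations.reduced {θ : ℝ} {V : SmoothFn M}
    (hV : ∀ i, i ≠ 1 → pderiv i V = 0) {N : VField M} (h : DeterminingEquations θ V N) :
    DeterminingEquations θ V (reduced θ N) ∧ pderiv 2 (reduced θ N 2) = 0 := by
  obtain ⟨t_q, t_S, t_E, t_B, q_q, q_S, q_E, q_B, S_E, S_B, E_eq, B_eq, S_SS, S_q, S_t⟩ := h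
  have e2 : HJB.reduced θ N 2 = N 2 - algebraMap ℝ _ (θ ^ 2) * pderiv 2 (N 2) := rfl
  have e1 : HJB.reduced θ N 1 = N 1 := rfl
  have e0 : HJB.reduced θ N 0 = N 0 := rfl
  have hS : pderiv 2 (HJB.reduced θ N 2) = 0 := by
    rw [e2, map_sub, pderiv_mul, Derivation.map_algebraMap, S_SS]
    ring
  refine ⟨⟨t_q, t_S, t_E, t_B, q_q, q_S, q_E, q_B, ?_, ?_, ?_, ?_, ?_, ?_, ?_⟩, hS⟩
  · simp [e2, S_E, pderiv_pderiv_eq_zero]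
  · simp [e2, S_B, pderiv_pderiv_eq_zero]
  · rw [hS, e2, e0, e1]
    change -(coord 3 * pderiv 0 (N 0)) - coord 4 * pderiv 0 (N 1) - pderiv 0 _ = _
    ring
  · rw [hS, e2, e1]
    change -(coord 4 * pderiv 1 (N 1)) - pderiv 1 _ = _
    ring
  · rw [hS, map_zero, mul_zero]
  · rw [hS, map_zero, mul_zero, e1, e2, map_sub, pderiv_mul, Derivation.map_algebraMap]
    linear_combination S_q
  · rw [hS, e0, e1, e2]
    have h1 := congrArg (pderiv 2) S_t
    simp only [map_add, pderiv_mul, Derivation.map_algebraMap, q_S, hV 2 (by decide),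
      pderiv_pderiv_eq_zero (hV 2 (by decide)), pderiv_pderiv_eq_zero t_S, pderiv_comm 2 0 (N 2),
      pderiv_comm 2 1] at h1
    simp only [map_sub, pderiv_mul, Derivation.map_algebraMap, map_add]
    simp only [map_zero, mul_zero, add_zero]
    -- Apply 1 − θ²∂_S to `S_t`; its right side then vanishes by `S_SS`.
    linear_combination S_t - algebraMap ℝ _ (θ ^ 2) * h1 - V * S_SS

/-! ### The canonical supplement in coordinates -/

theorem symmetryField_add (T l m T' l' m' : SmoothFn M) :
    symmetryField (T + T') (l + l') (m + m') = symmetryField T l m + symmetryField T' l' m' := by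
  ext1 i
  fin_cases i <;> simp [symmetryField, shift, phase, -Derivation.leibniz, pderiv_mul] <;> ring

theorem symmetryField_smul (r : ℝ) (T l m : SmoothFn M) :
    symmetryField (r • T) (r • l) (r • m) = r • symmetryField T l m := by
  ext1 i
  fin_cases i <;> simp [symmetryField, shift, phase, Algebra.smul_def] <;> ring

variable (M) in
/-- The solutions of `T''' = lam² T'`. -/
def timeParam (lam : ℝ) (c : Fin 6 → ℝ) : SmoothFn M :=
  algebraMap ℝ _ (c 0) + c 1 • sinhTime M lam + c 2 • primTime M lam

variable (M) in
/-- The solutions of `l'' = (lam / 2)² l`. -/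
def shiftParam (lam : ℝ) (c : Fin 6 → ℝ) : SmoothFn M :=
  c 3 • coshTime M (lam / 2) + c 4 • sinhTime M (lam / 2)

variable (M) in
/-- The solutions of `m' = (θ² / 4) T''`. -/
def phaseParam (θ lam : ℝ) (c : Fin 6 → ℝ) : SmoothFn M :=
  algebraMap ℝ _ (c 5) + algebraMap ℝ _ (θ ^ 2 / 2) * half M * pderiv 0 (timeParam M lam c)

theorem timeParam_add (lam : ℝ) (c d : Fin 6 → ℝ) :
    timeParam M lam (c + d) = timeParam M lam c + timeParam M lam d := by
  simp only [timeParam, Pi.add_apply, map_add, add_smul]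
  abel

theorem timeParam_smul (lam r : ℝ) (c : Fin 6 → ℝ) :
    timeParam M lam (r • c) = r • timeParam M lam c := by
  simp only [timeParam, Pi.smul_apply, smul_eq_mul, map_mul, Algebra.smul_def]
  ring

variable (M) in
/-- The six-parameter family of vector fields that spans the canonical supplement if `A = 0`. -/
def supplementParam (θ lam : ℝ) : (Fin 6 → ℝ) →ₗ[ℝ] VField M where
  toFun c := symmetryField (timeParam M lam c) (shiftParam M lam c) (phaseParam M θ lam c)
  map_add' c d := by
    rw [← symmetryField_add, timeParam_add]
    congr 1
    · simp only [shiftParam, Pi.add_apply, add_smul]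
      abel
    · simp only [phaseParam, timeParam_add, Pi.add_apply, map_add]
      ring
  map_smul' r c := by
    rw [RingHom.id_apply, ← symmetryField_smul, timeParam_smul]
    congr 1
    · simp only [shiftParam, Pi.smul_apply, smul_eq_mul, mul_smul, smul_add]
    · rw [phaseParam, timeParam_smul, Derivation.map_smul, Pi.smul_apply, smul_eq_mul, map_mul,
        Algebra.smul_def, Algebra.smul_def, phaseParam]
      ring

theorem isTimeFn_timeParam (lam : ℝ) (c : Fin 6 → ℝ) : IsTimeFn (timeParam M lam c) :=
  ((isTimeFn_algebraMap _).add ((isTimeFn_sinhTime _).smul _)).add ((isTimeFn_primTime _).smul _)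

theorem isTimeFn_shiftParam (lam : ℝ) (c : Fin 6 → ℝ) : IsTimeFn (shiftParam M lam c) :=
  ((isTimeFn_coshTime _).smul _).add ((isTimeFn_sinhTime _).smul _)

theorem isTimeFn_phaseParam (θ lam : ℝ) (c : Fin 6 → ℝ) : IsTimeFn (phaseParam M θ lam c) :=
  (isTimeFn_algebraMap _).add
    (((isTimeFn_algebraMap _).mul (isTimeFn_algebraMap _)).mul
      (isTimeFn_timeParam _ _).pderiv_zero)

theorem pderiv_timeParam (lam : ℝ) (c : Fin 6 → ℝ) :
    pderiv 0 (timeParam M lam c) = c 1 • coshTime M lam + c 2 • sinhTime M lam := by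
  simp [timeParam, pderiv_sinhTime, pderiv_primTime]

theorem pderiv_pderiv_timeParam (lam : ℝ) (c : Fin 6 → ℝ) :
    pderiv 0 (pderiv 0 (timeParam M lam c)) =
      c 1 • (algebraMap ℝ _ (lam ^ 2) * sinhTime M lam) + c 2 • coshTime M lam := by
  rw [pderiv_timeParam, map_add, Derivation.map_smul, Derivation.map_smul, pderiv_coshTime,
    pderiv_sinhTime]

theorem pderiv_shiftParam (lam : ℝ) (c : Fin 6 → ℝ) :
    pderiv 0 (shiftParam M lam c) =
      c 3 • (algebraMap ℝ _ ((lam / 2) ^ 2) * sinhTime M (lam / 2)) +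
        c 4 • coshTime M (lam / 2) := by
  rw [shiftParam, map_add, Derivation.map_smul, Derivation.map_smul, pderiv_coshTime,
    pderiv_sinhTime]

theorem eight_mul_coeffB (lam : ℝ) :
    8 * algebraMap ℝ (SmoothFn M) (coeffB lam) = algebraMap ℝ _ (lam ^ 2) := by
  rw [show (8 : SmoothFn M) = algebraMap ℝ _ 8 from (map_ofNat _ 8).symm, ← map_mul, coeffB]
  congr 1; ring

theorem two_mul_coeffB (lam : ℝ) :
    2 * algebraMap ℝ (SmoothFn M) (coeffB lam) = algebraMap ℝ _ ((lam / 2) ^ 2) := by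
  rw [show (2 : SmoothFn M) = algebraMap ℝ _ 2 from (map_ofNat _ 2).symm, ← map_mul, coeffB]
  congr 1; ring

/-- At t = 0 the value of the combination is c and its derivative is d. -/
theorem eq_zero_of_smul_coshTime_add {x : M} (hx : x.1 0 = 0) {μ c d : ℝ}
    (h : c • coshTime M μ + d • sinhTime M μ = 0) : c = 0 ∧ d = 0 := by
  have h0 := congrArg (SmoothFn.val · x) h
  have h1 := congrArg (SmoothFn.val · x) (congrArg (pderiv 0) h)
  simp only [map_add, Derivation.map_smul, pderiv_coshTime, pderiv_sinhTime, map_zero,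
    SmoothFn.add_apply, SmoothFn.smul_apply, SmoothFn.mul_apply, SmoothFn.zero_apply,
    coshTime_apply hx, sinhTime_apply hx] at h0 h1
  constructor <;> linarith

theorem supplementParam_injective (x : M) (hx : x.1 0 = 0) (θ lam : ℝ) :
    Function.Injective (supplementParam M θ lam) := by
  rw [← LinearMap.ker_eq_bot, LinearMap.ker_eq_bot']
  intro c hc
  have hT : timeParam M lam c = 0 := congrFun hc 0
  have hl : shiftParam M lam c = 0 := by
    have h : half M * pderiv 0 (timeParam M lam c) * coord 1 + shiftParam M lam c = 0 :=
      congrFun hc 1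
    simpa [hT] using h
  have hm : phaseParam M θ lam c = 0 := by
    have h : phase (timeParam M lam c) (shiftParam M lam c) (phaseParam M θ lam c) = 0 :=
      congrFun hc 2
    simpa [phase, hT, hl] using h
  obtain ⟨h1, h2⟩ := eq_zero_of_smul_coshTime_add hx
    ((pderiv_timeParam (M := M) lam c).symm.trans (by rw [hT, map_zero]))
  obtain ⟨h3, h4⟩ := eq_zero_of_smul_coshTime_add hx hl
  have h0 : c 0 = 0 := by
    rw [timeParam, h1, h2, zero_smul, zero_smul, add_zero, add_zero] at hT
    exact congrArg (SmoothFn.val · x) hT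
  have h5 : c 5 = 0 := by
    rw [phaseParam, hT, map_zero, mul_zero, add_zero] at hm
    exact congrArg (SmoothFn.val · x) hm
  ext i
  fin_cases i <;> assumption

/-- Parameters 0, 1, 2 describe T, parameters 3 and 4 describe l, and 5 is the constant in m. The
alternative on the parameters expresses a l = 0. -/
theorem mem_canonicalSupplement_iff (hM : Convex ℝ (M : Set Coords)) (x : M) (hx : x.1 0 = 0)
    {θ : ℝ} (hθ : θ ≠ 0) {V : SmoothFn M} {a lam : ℝ}
    (hV : coord 1 ^ 2 * V = algebraMap ℝ _ a + algebraMap ℝ _ (coeffB lam) * coord 1 ^ 4)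
    (N : VField M) : N ∈ canonicalSupplement θ V ↔
      ∃ c : Fin 6 → ℝ, (a = 0 ∨ c 3 = 0 ∧ c 4 = 0) ∧ supplementParam M θ lam c = N := by
  have hV' := pderiv_potential hV
  constructor
  · rintro ⟨hN, hS⟩
    obtain ⟨T, l, m, hT, hl, hm, eT, el, em, ha, rfl⟩ :=
      (determiningEquations_of_mem hθ hV' hN).eq_symmetryField hV hS
    rw [eight_mul_coeffB] at eT
    rw [two_mul_coeffB] at el
    obtain ⟨c1, c2, h12⟩ := hT.pderiv_zero.eq_of_second_order hM x eT
    obtain ⟨c3, c4, h34⟩ := hl.eq_of_second_order hM x el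
    obtain ⟨c0, h0⟩ := hT.eq_add_of_pderiv_eq hM x
      (g := c1 • sinhTime M lam + c2 • primTime M lam)
      (((isTimeFn_sinhTime _).smul _).add ((isTimeFn_primTime _).smul _))
      (by simp [h12, pderiv_sinhTime, pderiv_primTime])
    obtain ⟨c5, h5⟩ := hm.eq_add_of_pderiv_eq hM x
      (g := algebraMap ℝ _ (θ ^ 2 / 2) * half M * pderiv 0 T)
      (((isTimeFn_algebraMap _).mul (isTimeFn_algebraMap _)).mul hT.pderiv_zero)
      (by rw [em, pderiv_mul, pderiv_mul, pderiv_half, Derivation.map_algebraMap]; ring)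
    have eT' : timeParam M lam ![c0, c1, c2, c3, c4, c5] = T := by
      rw [h0, ← add_assoc]; rfl
    have el' : shiftParam M lam ![c0, c1, c2, c3, c4, c5] = l := h34.symm
    have em' : phaseParam M θ lam ![c0, c1, c2, c3, c4, c5] = m := by
      rw [h5, phaseParam, eT']; rfl
    refine ⟨![c0, c1, c2, c3, c4, c5], ?_, ?_⟩
    · by_cases ha0 : a = 0
      · exact Or.inl ha0
      · exact Or.inr (eq_zero_of_smul_coshTime_add hx
          (h34.symm.trans (algebraMap_mul_cancel ha0 ha)))
    · change symmetryField _ _ _ = _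
      rw [eT', el', em']
  · rintro ⟨c, hc, rfl⟩
    have hD : DeterminingEquations θ V (supplementParam M θ lam c) := by
      refine determiningEquations_symmetryField hV (isTimeFn_timeParam _ _)
        (isTimeFn_shiftParam _ _) (isTimeFn_phaseParam _ _ _) ?_ ?_ ?_ ?_
      · rw [pderiv_pderiv_timeParam, pderiv_timeParam, eight_mul_coeffB]
        simp only [Algebra.smul_def, map_add, pderiv_mul, Derivation.map_algebraMap,
          pderiv_coshTime, pderiv_sinhTime]
        ring
      · rw [pderiv_shiftParam, shiftParam, two_mul_coeffB]
        simp only [Algebra.smul_def, map_add, pderiv_mul, Derivation.map_algebraMap,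
          pderiv_coshTime, pderiv_sinhTime]
        ring
      · rw [phaseParam, map_add, pderiv_mul, pderiv_mul, pderiv_half]
        simp only [Derivation.map_algebraMap]
        ring
      · rcases hc with rfl | ⟨h3, h4⟩
        · rw [map_zero, zero_mul]
        · rw [shiftParam, h3, h4, zero_smul, zero_smul, add_zero, mul_zero]
    have hS : pderiv 2 (supplementParam M θ lam c 2) = 0 :=
      (pderiv_phase (isTimeFn_timeParam _ _) (isTimeFn_shiftParam _ _)
        (isTimeFn_phaseParam _ _ _)).2.2.1
    exact ⟨hD.mem_isovectors hV' hS, hS⟩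

/-! ### Dimension of the supplement. -/

theorem finrank_canonicalSupplement_of_eq_zero (hM : Convex ℝ (M : Set Coords)) (x : M)
    (hx : x.1 0 = 0) {θ : ℝ} (hθ : θ ≠ 0) {V : SmoothFn M} {a lam : ℝ}
    (hV : coord 1 ^ 2 * V = algebraMap ℝ _ a + algebraMap ℝ _ (coeffB lam) * coord 1 ^ 4)
    (ha : a = 0) : Module.finrank ℝ (canonicalSupplement θ V) = 6 := by
  have h : canonicalSupplement θ V = LinearMap.range (supplementParam M θ lam) := by
    ext N
    rw [mem_canonicalSupplement_iff hM x hx hθ hV]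
    simp [ha]
  rw [h, LinearMap.finrank_range_of_inj (supplementParam_injective x hx θ lam)]
  simp

/-- The parameters of the vector fields that preserve a potential with `A ≠ 0`. -/
def unshiftedParam : (Fin 4 → ℝ) →ₗ[ℝ] (Fin 6 → ℝ) where
  toFun c := ![c 0, c 1, c 2, 0, 0, c 3]
  map_add' c d := by ext i; fin_cases i <;> simp
  map_smul' r c := by ext i; fin_cases i <;> simp

theorem unshiftedParam_injective : Function.Injective unshiftedParam := by
  intro c d h
  ext i
  fin_cases i
  exacts [congrFun h 0, congrFun h 1, congrFun h 2, congrFun h 5]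

theorem finrank_canonicalSupplement_of_ne_zero (hM : Convex ℝ (M : Set Coords)) (x : M)
    (hx : x.1 0 = 0) {θ : ℝ} (hθ : θ ≠ 0) {V : SmoothFn M} {a lam : ℝ}
    (hV : coord 1 ^ 2 * V = algebraMap ℝ _ a + algebraMap ℝ _ (coeffB lam) * coord 1 ^ 4)
    (ha : a ≠ 0) : Module.finrank ℝ (canonicalSupplement θ V) = 4 := by
  have h : canonicalSupplement θ V =
      LinearMap.range (supplementParam M θ lam ∘ₗ unshiftedParam) := by
    ext N
    rw [mem_canonicalSupplement_iff hM x hx hθ hV]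
    constructor
    · rintro ⟨c, hc, rfl⟩
      obtain ⟨h3, h4⟩ := hc.resolve_left ha
      refine ⟨![c 0, c 1, c 2, c 5], congrArg (supplementParam M θ lam) (?_ : unshiftedParam _ = c)⟩
      ext i
      fin_cases i
      exacts [rfl, rfl, rfl, h3.symm, h4.symm, rfl]
    · rintro ⟨c, rfl⟩
      exact ⟨unshiftedParam c, Or.inr ⟨rfl, rfl⟩, rfl⟩
  rw [h, LinearMap.finrank_range_of_inj]
  · simp
  · exact (supplementParam_injective x hx θ lam).comp unshiftedParam_injective

/-! ### The direct sum decomposition on `ℝ⁵` restricted to `q ∈ J` -/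

variable {J : TopologicalSpace.Opens ℝ}

theorem convex_phaseSpace (hJ : IsConnected (J : Set ℝ)) :
    Convex ℝ (phaseSpace J : Set Coords) :=
  hJ.isPreconnected.ordConnected.convex.linear_preimage
    (LinearMap.proj 1 : Coords →ₗ[ℝ] ℝ)

theorem coord_sq_mul_potential (a b : ℝ) (h : a = 0 ∨ (0 : ℝ) ∉ J) :
    coord 1 ^ 2 * potential J a b h = algebraMap ℝ _ a + algebraMap ℝ _ b * coord 1 ^ 4 := by
  refine SmoothFn.ext fun x => ?_
  change x.1 1 ^ 2 * (a / x.1 1 ^ 2 + b * x.1 1 ^ 2) = a + b * x.1 1 ^ 4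
  rcases h with rfl | h
  · ring
  · have hq : x.1 1 ≠ 0 := fun h0 => h (h0 ▸ (show x.1 1 ∈ J from x.2))
    field_simp

theorem superposition_inf_canonicalSupplement (hJ : IsConnected (J : Set ℝ)) {θ : ℝ} (hθ : θ ≠ 0)
    {V : SmoothFn (phaseSpace J)} (hV : ∀ i, i ≠ 1 → pderiv i V = 0) :
    superposition θ V ⊓ canonicalSupplement θ V = ⊥ := by
  rw [eq_bot_iff]
  rintro N ⟨⟨hN, h0, h1, u, hu⟩, -, hS⟩
  have hD := determiningEquations_of_mem hθ hV hN
  have h2 : N 2 = 0 := by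
    refine SmoothFn.ext fun x => ?_
    -- Shifting S by θ² multiplies e^{S/θ²} u by e but leaves an S-free function unchanged.
    let y : phaseSpace J := ⟨Function.update x.1 2 (x.1 2 + θ ^ 2), x.2⟩
    have hxy := val_eq_of_pderiv_eq_zero (convex_phaseSpace hJ) (N 2) x y (fun i hi => by
      by_cases h : i = 2
      · rw [h, hS]
      · exact absurd (Function.update_of_ne h _ _).symm hi)
    rw [hu, hu] at hxy
    have e : Real.exp (y.1 2 / θ ^ 2) = Real.exp (x.1 2 / θ ^ 2) * Real.exp 1 := by
      rw [← Real.exp_add]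
      congr 1
      change (x.1 2 + θ ^ 2) / θ ^ 2 = _
      field_simp
    change _ = Real.exp (y.1 2 / θ ^ 2) * u (x.1 0) (x.1 1) at hxy
    rw [e, mul_right_comm, ← hu] at hxy
    have h1 : Real.exp 1 - 1 ≠ 0 := by
      have := Real.exp_one_gt_d9
      linarith
    exact (mul_eq_zero.1 (show (N 2).val x * (Real.exp 1 - 1) = 0 by linarith)).resolve_right h1
  have h3 := hD.E_eq
  have h4 := hD.B_eq
  rw [h0, h1, h2] at h3
  rw [h1, h2] at h4
  simp only [map_zero, mul_zero, sub_zero] at h3 h4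
  ext1 i
  fin_cases i
  exacts [h0, h1, h2, h3, h4]

/-- The part removed by `reduced` is a difference of isovectors with no t or q component; only the
shape of its phase f = θ² ∂_S N^S is left to check, and f e^{−S/θ²} depends on (t, q) only. -/
theorem superposition_sup_canonicalSupplement (hJ : IsConnected (J : Set ℝ)) {θ : ℝ} (hθ : θ ≠ 0)
    {V : SmoothFn (phaseSpace J)} (hV : ∀ i, i ≠ 1 → pderiv i V = 0) :
    superposition θ V ⊔ canonicalSupplement θ V = isovectors θ V := by
  refine le_antisymm (sup_le (fun N h => h.1) fun N h => h.1) fun N hN => ?_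
  have hD := determiningEquations_of_mem hθ hV hN
  obtain ⟨hR, hRS⟩ := hD.reduced hV
  have hRm := hR.mem_isovectors hV hRS
  refine Submodule.mem_sup.2 ⟨N - reduced θ N, ⟨sub_mem hN hRm, sub_self _, sub_self _, ?_⟩,
    reduced θ N, ⟨hRm, hRS⟩, sub_add_cancel _ _⟩
  obtain ⟨f, hf⟩ : ∃ f, f = (N - reduced θ N) 2 := ⟨_, rfl⟩
  have hf' : f = algebraMap ℝ _ (θ ^ 2) * pderiv 2 (N 2) := by
    rw [hf]
    change N 2 - (N 2 - _) = _
    ring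
  have fS : algebraMap ℝ _ (θ ^ 2) * pderiv 2 f = f := by
    rw [hf', pderiv_mul, Derivation.map_algebraMap, mul_zero, add_zero, hD.S_SS]
  let e : SmoothFn (phaseSpace J) := ofCoord 2 (fun s => Real.exp (-s / θ ^ 2))
    (Real.contDiff_exp.comp (contDiff_neg.div_const _))
  have he (j : Fin 5) (x : phaseSpace J) : (pderiv j e).val x =
      if j = 2 then Real.exp (-x.1 2 / θ ^ 2) * (-1 / θ ^ 2) else 0 :=
    pderiv_ofCoord_apply 2 j _ (fun s => ((hasDerivAt_neg s).div_const (θ ^ 2)).exp) x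
  have hw (i : Fin 5) (h0 : i ≠ 0) (h1 : i ≠ 1) : pderiv i (f * e) = 0 := by
    by_cases h2 : i = 2
    · subst h2
      refine SmoothFn.ext fun x => ?_
      have hx := congrArg (SmoothFn.val · x) fS
      simp only [SmoothFn.mul_apply, algebraMap_apply] at hx
      rw [pderiv_mul, SmoothFn.add_apply, SmoothFn.mul_apply, SmoothFn.mul_apply, he, if_pos rfl,
        SmoothFn.zero_apply]
      change _ + Real.exp (-x.1 2 / θ ^ 2) * _ = 0
      rw [← hx]
      field_simp
      ring
    · have hf0 : pderiv i f = 0 := by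
        rw [hf', pderiv_mul, Derivation.map_algebraMap, mul_zero, add_zero]
        have : i = 3 ∨ i = 4 := by omega
        rcases this with rfl | rfl
        · rw [pderiv_pderiv_eq_zero hD.S_E, mul_zero]
        · rw [pderiv_pderiv_eq_zero hD.S_B, mul_zero]
      have he0 : pderiv i e = 0 := SmoothFn.ext fun x => by rw [he, if_neg h2]; rfl
      rw [pderiv_mul, hf0, he0, mul_zero, mul_zero, add_zero]
  classical
  -- u is f on the slice S = E = B = 0, where the exponential factor is 1. The value 0 for q ∉ J is
  -- never used.
  refine ⟨fun t q => if h : (![t, q, 0, 0, 0] : Coords) ∈ phaseSpace J then f.val ⟨_, h⟩ else 0,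
    fun x => ?_⟩
  have hq : (![x.1 0, x.1 1, 0, 0, 0] : Coords) ∈ phaseSpace J := x.2
  rw [← hf]
  dsimp only
  rw [dif_pos hq]
  have h := val_eq_of_pderiv_eq_zero (convex_phaseSpace hJ) (f * e) x
    ⟨![x.1 0, x.1 1, 0, 0, 0], hq⟩ (fun i hi => hw i (by rintro rfl; exact hi rfl)
      (by rintro rfl; exact hi rfl))
  rw [SmoothFn.mul_apply, SmoothFn.mul_apply] at h
  change f.val x * Real.exp (-x.1 2 / θ ^ 2) = _ * Real.exp (-0 / θ ^ 2) at h
  rw [neg_zero, zero_div, Real.exp_zero, mul_one] at h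
  rw [← h, mul_left_comm, ← Real.exp_add, neg_div, add_neg_cancel, Real.exp_zero, mul_one]

end HJB
end

/-! ### The affine potential. -/

theorem corollary6p2 (α β lam φ : ℝ) (hα : α ≠ 0)
    (J : TopologicalSpace.Opens ℝ) (hJ : IsConnected (J : Set ℝ))
    (h0 : HJB.coeffA α β lam φ = 0 ∨ (0 : ℝ) ∉ J) :
    (HJB.superposition (α / 2) (HJB.affinePotential J α β lam φ h0) ⊓ HJB.canonicalSupplement (α / 2) (HJB.affinePotential J α β lam φ h0) = ⊥ ∧
      HJB.superposition (α / 2) (HJB.affinePotential J α β lam φ h0) ⊔ HJB.canonicalSupplement (α / 2) (HJB.affinePotential J α β lam φ h0) = HJB.isovectors (α / 2) (HJB.affinePotential J α β lam φ h0)) ∧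
    (HJB.coeffA α β lam φ = 0 → Module.finrank ℝ (HJB.canonicalSupplement (α / 2) (HJB.affinePotential J α β lam φ h0)) = 6) ∧
    (HJB.coeffA α β lam φ ≠ 0 → Module.finrank ℝ (HJB.canonicalSupplement (α / 2) (HJB.affinePotential J α β lam φ h0)) = 4) ∧
    (Module.finrank ℝ (HJB.canonicalSupplement (α / 2) (HJB.affinePotential J α β lam φ h0)) = 6 ↔
      HJB.phiTilde α β lam φ ∈ ({α / 4, 3 * α / 4} : Set ℝ)) := by
  have hθ : α / 2 ≠ 0 := div_ne_zero hα two_ne_zero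
  have hV := HJB.coord_sq_mul_potential (HJB.coeffA α β lam φ) (HJB.coeffB lam) h0
  have hV' := HJB.pderiv_potential hV
  have hM := HJB.convex_phaseSpace hJ
  obtain ⟨q, hq⟩ := hJ.nonempty
  -- A base point with t = 0, where the parameters are read off.
  let x : HJB.phaseSpace J := ⟨![0, q, 0, 0, 0], hq⟩
  have h6 := HJB.finrank_canonicalSupplement_of_eq_zero hM x rfl hθ hV
  have h4 := HJB.finrank_canonicalSupplement_of_ne_zero hM x rfl hθ hV
  have hA : HJB.coeffA α β lam φ = 0 ↔
      HJB.phiTilde α β lam φ ∈ ({α / 4, 3 * α / 4} : Set ℝ) := by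
    rw [HJB.coeffA, mul_eq_zero, mul_eq_zero, sub_eq_zero, sub_eq_zero]
    simp [hα]
  refine ⟨⟨HJB.superposition_inf_canonicalSupplement hJ hθ hV',
    HJB.superposition_sup_canonicalSupplement hJ hθ hV'⟩, h6, h4, ?_⟩
  rw [← hA]
  refine ⟨fun h => ?_, h6⟩
  by_contra hne
  have := (h4 hne).symm.trans h
  omega
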